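/- **Setup.** Fix integers $n\ge 1$ and $d$, a Lebesgue probability density $\pi:\mathbb R^d\to[0,\infty)$ (the prior) and a measurable $L_n:\mathbb R^d\to\mathbb R$ (the generalized log-likelihood). Let $\Pi_n(\theta)=e^{L_n(\theta)}\pi(\theta)/z_n$ with $z_n=\int e^{L_n}\pi$ be the generalized posterior density, $\overline L_n=\log \Pi_n$ (with $\log 0=-\infty$), and let $\tilde\theta_n$ be a random variable with density $\Pi_n$. Put $\hat J_n(\theta)=-L_n''(\theta)/n$ and $\bar J_n(\theta)=-\overline L_n''(\theta)/n$. Let $\|\cdot\|$ be the Euclidean norm, $\|\cdot\|_{op}$ the spectral norm, $\|f'''(\theta)\|^*=\sup_{\|u\|,\|v\|,\|w\|\le1}|f'''(\theta)[u,v,w]|$, and $TV(\mu,\nu)=\sup_A|\mu(A)-\nu(A)|$ over measurable sets $A$. **Assumptions.** There are real numbers $\delta,\bar\delta,M_2,\overline M_2,\hat M_1,\bar\kappa>0$ such that: 1. $L_n$ has a unique global maximizer $\hat\theta_n$ (the MLE); $L_n$ is three times differentiable at every $\theta$ with $\|\theta-\hat\theta_n\|\le\delta$, and $\|L_n'''(\theta)\|^*/n\le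 M_2$ for all such $\theta$. 2. $\pi(\theta)>0$ and $1/\pi(\theta)\le\hat M_1$ whenever $\|\theta-\hat\theta_n\|\le\delta$. 3. $\overline L_n$ has a unique global maximizer $\bar\theta_n$ (the MAP); for every $\theta$ with $\|\theta-\bar\theta_n\|\le\bar\delta$, $\pi(\theta)>0$, both $\log\pi$ and $\overline L_n$ are three times differentiable at $\theta$, and $\|\overline L_n'''(\theta)\|^*/n\le\overline M_2$. 4. With $\hat J^p_n=\hat J_n(\hat\theta_n)+\frac{\delta M_2}{3}I_{d\times d}$, $$\max\Big\{\|\hat\theta_n-\bar\theta_n\|,\sqrt{\operatorname{Tr}[\bar J_n(\bar\theta_n)^{-1}]/n}\Big\}<\bar\delta,\qquad \sqrt{\operatorname{Tr}[(\hat J^p_n)^{-1}]/n}<\delta .$$ 5. The smallest eigenvalue $\bar\lambda_{\min}$ of $\bar J_n(\bar\theta_n)$ satisfies $\bar\lambda_{\min}>\bar\delta\,\overline M_2$. 6. $\dfrac{L_n(\theta)-L_n(\hat\theta_n)}{n}\le-\bar\kappa$ whenever $\|\theta-\hat\theta_n\|>\bar\delta-\|\hat\theta_n-\bar\theta_n\|$.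 **Conclusion.** With $\hat\lambda^p_{\min}=\|(\hat J^p_n)^{-1}\|_{op}^{-1}$, $$\bar{\mathscr D}=\exp\Big[-\tfrac12\Big(\bar\delta\sqrt n-\sqrt{\operatorname{Tr}[\bar J_n(\bar\theta_n)^{-1}]}\Big)^2\bar\lambda_{\min}\Big],\qquad \hat{\mathscr D}^p=\exp\Big[-\tfrac12\Big(\delta\sqrt n-\sqrt{\operatorname{Tr}[(\hat J^p_n)^{-1}]}\Big)^2\hat\lambda^p_{\min}\Big],$$ one has $$TV\Big(\mathcal L\big(\sqrt n(\tilde\theta_n-\bar\theta_n)\big),\mathcal N(0,\bar J_n(\bar\theta_n)^{-1})\Big)\le \frac{\sqrt3\,\operatorname{Tr}[\bar J_n(\bar\theta_n)^{-1}]\,\overline M_2}{4\sqrt{n(\bar\lambda_{\min}-\bar\delta\,\overline M_2)(1-\bar{\mathscr D})}}+2\bar{\mathscr D}+\frac{2n^{d/2}e^{-n\bar\kappa}\hat M_1|\det\hat J^p_n|^{1/2}}{(2\pi)^{d/2}(1-\hat{\mathscr D}^p)},$$ where in the last denominator $\pi$ denotes the number pi. -/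

import Mathlib

open MeasureTheory ProbabilityTheory Filter Topology

set_option maxSynthPendingDepth 3

noncomputable section

namespace LaplaceApprox

/-- The parameter space `ℝ^d` with the Euclidean norm. -/
abbrev Param (d : ℕ) : Type := EuclideanSpace ℝ (Fin d)

/-! ### Maximisers, derivatives, matrices -/

/-- `x` is the unique global maximiser of `f`. -/
def IsUniqueArgmax {α : Type*} (f : α → ℝ) (x : α) : Prop :=
  (∀ y, f y ≤ f x) ∧ ∀ y, (∀ z, f z ≤ f y) → y = x

/-- `f` is three times (Fréchet) differentiable at `x`: its first two derivatives exist near `x`,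
and the second derivative is differentiable at `x`. -/
def ThriceDifferentiableAt {d : ℕ} (f : Param d → ℝ) (x : Param d) : Prop :=
  (∀ᶠ y in 𝓝 x, DifferentiableAt ℝ f y) ∧
    (∀ᶠ y in 𝓝 x, DifferentiableAt ℝ (fderiv ℝ f) y) ∧
    DifferentiableAt ℝ (fderiv ℝ (fderiv ℝ f)) x

/-- The Hessian matrix of `f` at `x`, with entries `∂ᵢ ∂ⱼ f (x)`. -/
def hessian {d : ℕ} (f : Param d → ℝ) (x : Param d) : Matrix (Fin d) (Fin d) ℝ :=
  Matrix.of fun i j =>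
    fderiv ℝ (fderiv ℝ f) x (EuclideanSpace.single i 1) (EuclideanSpace.single j 1)

/-- The norm `sup {|f'''(x)[u, v, w]| : ‖u‖ ≤ 1, ‖v‖ ≤ 1, ‖w‖ ≤ 1}` of the third derivative of
`f` at `x` (a supremum of a bounded set, the third derivative being a trilinear form). -/
def thirdDerivNorm {d : ℕ} (f : Param d → ℝ) (x : Param d) : ℝ :=
  sSup {r : ℝ | ∃ u v w : Param d, ‖u‖ ≤ 1 ∧ ‖v‖ ≤ 1 ∧ ‖w‖ ≤ 1 ∧
    r = |fderiv ℝ (fderiv ℝ (fderiv ℝ f)) x u v w|}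

/-- The least (real) eigenvalue of a symmetric matrix. -/
def minEigenvalue {d : ℕ} (A : Matrix (Fin d) (Fin d) ℝ) : ℝ :=
  sInf {μ : ℝ | Module.End.HasEigenvalue (Matrix.toLin' A) μ}

/-- The operator (spectral) norm of a matrix. -/
def opNorm {d : ℕ} (A : Matrix (Fin d) (Fin d) ℝ) : ℝ :=
  ‖Matrix.toEuclideanCLM (n := Fin d) (𝕜 := ℝ) A‖

/-! ### Total variation distance -/

/-- The total variation distance `sup {|μ A - ν A| : A measurable}`. -/
def tvDist {Ω : Type*} [MeasurableSpace Ω] (μ ν : Measure Ω) : ℝ :=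
  ⨆ A : {A : Set Ω // MeasurableSet A}, |μ.real A.1 - ν.real A.1|

/-! ### The generalized posterior -/

/-- `prior` is a probability density with respect to Lebesgue measure. -/
structure IsProbDensity {d : ℕ} (prior : Param d → ℝ) : Prop where
  aemeasurable : AEMeasurable prior volume
  nonneg : ∀ θ, 0 ≤ prior θ
  lintegral_eq_one : ∫⁻ θ, ENNReal.ofReal (prior θ) = 1

/-- The normalizing constant `zₙ = ∫ exp (Lₙ θ) π(θ) dθ`. -/
def normConst {d : ℕ} (prior L : Param d → ℝ) : ℝ :=
  ∫ θ, Real.exp (L θ) * prior θ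

/-- The density `Πₙ(θ) = exp (Lₙ θ) π(θ) / zₙ` of the generalized posterior. -/
def postDensity {d : ℕ} (prior L : Param d → ℝ) (θ : Param d) : ℝ :=
  Real.exp (L θ) * prior θ / normConst prior L

/-- The generalized posterior measure. -/
def posterior {d : ℕ} (prior L : Param d → ℝ) : Measure (Param d) :=
  (volume : Measure (Param d)).withDensity fun θ => ENNReal.ofReal (postDensity prior L θ)

/-- The generalized log-posterior `log Πₙ`. It is only used around points at which the prior
density is positive. -/
def logPosterior {d : ℕ} (prior L : Param d → ℝ) (θ : Param d) : ℝ :=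
  Real.log (postDensity prior L θ)

/-- `θhat` is the unique maximum likelihood estimator. -/
def IsMLE {d : ℕ} (L : Param d → ℝ) (θhat : Param d) : Prop :=
  IsUniqueArgmax L θhat

/-- `θbar` is the unique maximum a posteriori estimator. The maximiser of `log Πₙ`, with
`log 0 = -∞`, is the maximiser of `Πₙ`, and the latter avoids the convention
`Real.log 0 = 0`. -/
def IsMAP {d : ℕ} (prior L : Param d → ℝ) (θbar : Param d) : Prop :=
  IsUniqueArgmax (postDensity prior L) θbar

/-! ### The quantities entering the bound -/

/-- `Ĵₙ(θ) = - Lₙ''(θ) / n`. -/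
def Jhat {d : ℕ} (n : ℕ) (L : Param d → ℝ) (θ : Param d) : Matrix (Fin d) (Fin d) ℝ :=
  -((n : ℝ)⁻¹ • hessian L θ)

/-- `J̄ₙ(θ) = - (log Πₙ)''(θ) / n`. -/
def Jbar {d : ℕ} (n : ℕ) (prior L : Param d → ℝ) (θ : Param d) : Matrix (Fin d) (Fin d) ℝ :=
  -((n : ℝ)⁻¹ • hessian (logPosterior prior L) θ)

/-- `Ĵᵖₙ(θ, δ) = Ĵₙ(θ) + (δ M₂ / 3) I`. -/
def JhatP {d : ℕ} (n : ℕ) (L : Param d → ℝ) (M₂ : ℝ) (θ : Param d) (δ : ℝ) :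
    Matrix (Fin d) (Fin d) ℝ :=
  Jhat n L θ + (δ * M₂ / 3) • (1 : Matrix (Fin d) (Fin d) ℝ)

/-- `λ̄_min(θ)`, the least eigenvalue of `J̄ₙ(θ)`. -/
def lamBar {d : ℕ} (n : ℕ) (prior L : Param d → ℝ) (θ : Param d) : ℝ :=
  minEigenvalue (Jbar n prior L θ)

/-- `λ̂ᵖ_min(θ, δ) = ‖Ĵᵖₙ(θ, δ)⁻¹‖_op⁻¹`. -/
def lamHatP {d : ℕ} (n : ℕ) (L : Param d → ℝ) (M₂ : ℝ) (θ : Param d) (δ : ℝ) : ℝ :=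
  (opNorm (JhatP n L M₂ θ δ)⁻¹)⁻¹

/-- `D̄(n, δ̄) = exp (-(1/2) (δ̄ √n - √Tr[J̄ₙ(θ̄)⁻¹])² λ̄_min(θ̄))`. -/
def decayBar {d : ℕ} (n : ℕ) (prior L : Param d → ℝ) (θbar : Param d) (δbar : ℝ) : ℝ :=
  Real.exp (-(1 / 2) *
    (δbar * √(n : ℝ) - √((Jbar n prior L θbar)⁻¹.trace)) ^ 2 * lamBar n prior L θbar)

/-- `D̂ᵖ(n, δ) = exp (-(1/2) (δ √n - √Tr[Ĵᵖₙ(θ̂, δ)⁻¹])² λ̂ᵖ_min(θ̂, δ))`. -/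
def decayHatP {d : ℕ} (n : ℕ) (L : Param d → ℝ) (M₂ : ℝ) (θhat : Param d) (δ : ℝ) : ℝ :=
  Real.exp (-(1 / 2) *
    (δ * √(n : ℝ) - √((JhatP n L M₂ θhat δ)⁻¹.trace)) ^ 2 * lamHatP n L M₂ θhat δ)

end LaplaceApprox

end

noncomputable section

namespace LaplaceApprox

open scoped ENNReal MatrixOrder

/-! ### The Prékopa–Leindler inequality at the midpoint -/

/-! Both laws are cut down to the ball `K` of radius `δbar * √n` about the rescaled MAP and compared
there. The two tails outside `K` are paid for separately.

Inside `K` the rescaled negative log-posterior `V` is strongly convex with constant `ρ = lam - δbar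
* Mbar₂`: its Hessian at the MAP is at least `lam`, and the third-derivative bound lets it drop by
at most `δbar * Mbar₂`. Let `P` be the truncated posterior, `ν` the truncated Gaussian with
potential `W`, and `φ = √(dν/dP)`. Le Cam's inequality gives `TV ≤ √(1 - (∫ φ dP)²) = √(Var_P φ)`.
The Poincaré inequality for `P` bounds the variance by `ρ⁻¹ ∫ |∇φ|² dP`, that is, by `∫ |∇(V - W)|²
dν / (4ρ)`. This is the constant that log-Sobolev followed by Pinsker would give. By Taylor's
formula `|∇(V - W)(x)| ≤ Mbar₂ ‖x‖² / (2√n)`, and a Gaussian satisfies `E‖x‖⁴ ≤ 3 (Tr J⁻¹)²`.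
Passing to `ν` costs a factor `(1 - D)⁻¹`, and the first term of the bound results
(`abs_gibbs_sub_gibbs_le`, `abs_gaussian_sub_gibbs_le`).

The Poincaré inequality (`integral_sq_sub_sq_integral_le`) comes from Prékopa–Leindler by Maurey's
argument, expanded to second order in a small parameter. The gradient enters only through a
one-sided increment bound between pairs of points, so no boundary regularity of `K` matters.

The Gaussian tail is a Chernoff bound for a weighted chi-square variable
(`multivariateGaussian_norm_gt_le`). For the posterior tail, the likelihood off `K` is at most `exp
(L θhat - n κbar)`, while the normalizing constant is bounded below by a Gaussian integral around
the MLE (`le_normConst`). The shift `δ M₂ / 3` in the precision matrix is what absorbs the cubic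
Taylor remainder there. -/

/-- The Prékopa–Leindler inequality for `μ`, for midpoints. -/
def MidpointPrekopaLeindler {E : Type*} [AddCommGroup E] [Module ℝ E] [MeasurableSpace E]
    (μ : Measure E) : Prop :=
  ∀ f g h : E → ℝ≥0∞, Measurable f → Measurable g → Measurable h →
    (∀ x y, f x * g y ≤ h ((2⁻¹ : ℝ) • (x + y)) ^ 2) →
    (∫⁻ x, f x ∂μ) * (∫⁻ x, g x ∂μ) ≤ (∫⁻ x, h x ∂μ) ^ 2

lemma _root_.ENNReal.four_mul_le_add_sq (a b : ℝ≥0∞) : 4 * (a * b) ≤ (a + b) ^ 2 := by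
  rcases eq_or_ne a ∞ with rfl | ha
  · simp
  rcases eq_or_ne b ∞ with rfl | hb
  · simp
  lift a to NNReal using ha
  lift b to NNReal using hb
  norm_cast
  have : (4 * (a * b) : ℝ) ≤ (a + b) ^ 2 := by nlinarith [sq_nonneg ((a : ℝ) - b)]
  exact_mod_cast this

/-- One-dimensional Brunn–Minkowski. The translates `A + min B` and `max A + B` both lie in the
sumset and meet only at `max A + min B`, so their lengths add. -/
lemma volume_add_le_of_isCompact {A B C : Set ℝ} (hA : IsCompact A) (hB : IsCompact B)
    (hA0 : A.Nonempty) (hB0 : B.Nonempty) (h : ∀ a ∈ A, ∀ b ∈ B, a + b ∈ C) :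
    volume A + volume B ≤ volume C := by
  obtain ⟨a, ha, ha'⟩ := hA.exists_isGreatest hA0
  obtain ⟨b, hb, hb'⟩ := hB.exists_isLeast hB0
  have h1 : volume ((fun x => x + b) '' A) = volume A := by
    rw [Set.image_add_right, measure_preimage_add_right]
  have h2 : volume ((fun x => a + x) '' B) = volume B := by
    rw [Set.image_add_left, measure_preimage_add]
  have hd : AEDisjoint volume ((fun x => x + b) '' A) ((fun x => a + x) '' B) := by
    refine measure_mono_null (t := {a + b}) ?_ (by simp)
    rintro _ ⟨⟨x, hx, rfl⟩, ⟨y, hy, hxy⟩⟩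
    have := ha' hx
    have := hb' hy
    simp only at hxy ⊢
    simp only [Set.mem_singleton_iff]
    linarith
  rw [← h1, ← h2, ← measure_union₀ (hB.image (by fun_prop)).measurableSet.nullMeasurableSet hd]
  apply measure_mono
  rintro _ (⟨x, hx, rfl⟩ | ⟨y, hy, rfl⟩)
  · exact h _ hx _ hb
  · exact h _ ha _ hy

lemma volume_add_le {A B C : Set ℝ} (hA : MeasurableSet A) (hB : MeasurableSet B)
    (hA0 : A.Nonempty) (hB0 : B.Nonempty) (h : ∀ a ∈ A, ∀ b ∈ B, a + b ∈ C) :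
    volume A + volume B ≤ volume C := by
  obtain ⟨a, ha⟩ := hA0
  obtain ⟨b, hb⟩ := hB0
  rw [hA.measure_eq_iSup_isCompact, hB.measure_eq_iSup_isCompact]
  simp only [iSup_and']
  refine ENNReal.biSup_add_biSup_le' (p := fun K => K ⊆ A ∧ IsCompact K)
    (q := fun K => K ⊆ B ∧ IsCompact K) ⟨∅, by simp⟩ ⟨∅, by simp⟩ ?_
  rintro K ⟨hKA, hK⟩ K' ⟨hKB, hK'⟩
  -- The approximating compacts may be empty, where the compact case says nothing. A point of each
  -- set is adjoined.
  calc volume K + volume K' ≤ volume (K ∪ {a}) + volume (K' ∪ {b}) := by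
        gcongr <;> exact Set.subset_union_left
    _ ≤ volume C := by
        refine volume_add_le_of_isCompact (hK.union isCompact_singleton)
          (hK'.union isCompact_singleton) ⟨a, by simp⟩ ⟨b, by simp⟩ fun x hx y hy => h x ?_ y ?_
        · rcases hx with hx | hx
          · exact hKA hx
          · rw [Set.mem_singleton_iff.1 hx]; exact ha
        · rcases hy with hx | hx
          · exact hKB hx
          · rw [Set.mem_singleton_iff.1 hx]; exact hb

lemma lintegral_eq_lintegral_volume_lt {f : ℝ → ℝ≥0∞} (hf : Measurable f) (hf' : ∀ x, f x ≠ ∞) :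
    ∫⁻ x, f x = ∫⁻ t in Set.Ioi (0 : ℝ), volume {x | ENNReal.ofReal t < f x} := by
  have h := lintegral_eq_lintegral_meas_lt volume (f := fun x => (f x).toReal)
    (Eventually.of_forall fun x => ENNReal.toReal_nonneg) hf.ennreal_toReal.aemeasurable
  simp only [ENNReal.ofReal_toReal (hf' _)] at h
  rw [h]
  refine setLIntegral_congr_fun measurableSet_Ioi fun t ht => ?_
  simp only [ENNReal.ofReal_lt_iff_lt_toReal (le_of_lt ht) (hf' _)]

/-- With equal suprema, the superlevel sets of `f` and `g` at height `t` are both nonempty or both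
empty (up to `t = 1`). In the first case their sumset lies in twice the superlevel set of `h`.
Brunn–Minkowski at each height and the layer-cake formula finish. The normalization yields a sum on
the left, which is stronger than a product. -/
lemma lintegral_add_le_of_iSup_eq_one {f g h : ℝ → ℝ≥0∞} (hf : Measurable f) (hg : Measurable g)
    (hh : Measurable h) (hf1 : ⨆ x, f x = 1) (hg1 : ⨆ x, g x = 1) (hh1 : ∀ x, h x ≠ ∞)
    (H : ∀ x y, f x * g y ≤ h ((2⁻¹ : ℝ) • (x + y)) ^ 2) :
    (∫⁻ x, f x) + ∫⁻ x, g x ≤ 2 * ∫⁻ x, h x := by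
  have hf2 : ∀ x, f x ≤ 1 := fun x => hf1 ▸ le_iSup f x
  have hg2 : ∀ x, g x ≤ 1 := fun x => hg1 ▸ le_iSup g x
  rw [lintegral_eq_lintegral_volume_lt hf fun x => ((hf2 x).trans_lt ENNReal.one_lt_top).ne,
    lintegral_eq_lintegral_volume_lt hg fun x => ((hg2 x).trans_lt ENNReal.one_lt_top).ne,
    lintegral_eq_lintegral_volume_lt hh hh1, ← lintegral_const_mul' _ _ (by simp),
    ← lintegral_add_left]
  swap
  · refine Antitone.measurable fun s t hst => measure_mono fun x hx => ?_
    exact (ENNReal.ofReal_le_ofReal hst).trans_lt hx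
  refine setLIntegral_mono' measurableSet_Ioi fun t ht => ?_
  rcases le_or_gt 1 (ENNReal.ofReal t) with h1 | h1
  · have e1 : {x | ENNReal.ofReal t < f x} = ∅ := by
      ext x; simpa using (hf2 x).trans h1
    have e2 : {x | ENNReal.ofReal t < g x} = ∅ := by
      ext x; simpa using (hg2 x).trans h1
    simp [e1, e2]
  · have n1 : {x | ENNReal.ofReal t < f x}.Nonempty := by
      obtain ⟨x, hx⟩ := lt_iSup_iff.1 (hf1.symm ▸ h1)
      exact ⟨x, hx⟩
    have n2 : {x | ENNReal.ofReal t < g x}.Nonempty := by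
      obtain ⟨x, hx⟩ := lt_iSup_iff.1 (hg1.symm ▸ h1)
      exact ⟨x, hx⟩
    have key := volume_add_le (C := (fun x => (2⁻¹ : ℝ) * x) ⁻¹' {x | ENNReal.ofReal t < h x})
      (measurableSet_lt measurable_const hf) (measurableSet_lt measurable_const hg) n1 n2 (by
        intro a ha b hb
        simp only [Set.mem_ofPred_eq, Set.mem_preimage] at ha hb ⊢
        have h3 := H a b
        rw [smul_eq_mul] at h3
        refine (ENNReal.pow_lt_pow_left_iff two_ne_zero).1 (lt_of_lt_of_le ?_ h3)
        rw [sq]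
        exact ENNReal.mul_lt_mul ha hb)
    refine key.trans ?_
    rw [Real.volume_preimage_mul_left (by norm_num)]
    simp

/-- For bounded functions, divide `f`, `g`, `h` by `sup f`, `sup g` and the geometric mean of these
suprema; the normalized additive inequality and AM–GM give the product form. Truncation removes the
boundedness. -/
lemma midpointPrekopaLeindler_real : MidpointPrekopaLeindler (volume : Measure ℝ) := by
  have bdd : ∀ f g h : ℝ → ℝ≥0∞, Measurable f → Measurable g → Measurable h →
      (∀ x, h x ≠ ∞) → (⨆ x, f x ≠ ∞) → (⨆ x, g x ≠ ∞) →
      (∀ x y, f x * g y ≤ h ((2⁻¹ : ℝ) • (x + y)) ^ 2) →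
      (∫⁻ x, f x) * (∫⁻ x, g x) ≤ (∫⁻ x, h x) ^ 2 := by
    intro f g h hf hg hh hh1 hfa hgb H
    rcases eq_or_ne (⨆ x, f x) 0 with ha | ha
    · have : ∀ x, f x = 0 := by simpa using ha
      simp [this]
    rcases eq_or_ne (⨆ x, g x) 0 with hb | hb
    · have : ∀ x, g x = 0 := by simpa using hb
      simp [this]
    set a := ⨆ x, f x with ha'
    set b := ⨆ x, g x with hb'
    set c : ℝ≥0∞ := (a * b) ^ (2⁻¹ : ℝ) with hc
    have hc2 : c ^ 2 = a * b := by
      rw [hc, ← ENNReal.rpow_natCast, ← ENNReal.rpow_mul]; simp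
    have hc0 : c ≠ 0 := by
      intro h0; rw [h0] at hc2; simp at hc2; tauto
    have hct : c ≠ ∞ := by
      intro h0; rw [h0] at hc2; simp at hc2
      exact ENNReal.mul_ne_top hfa hgb hc2.symm
    have key := lintegral_add_le_of_iSup_eq_one (f := fun x => a⁻¹ * f x)
      (g := fun x => b⁻¹ * g x) (h := fun x => c⁻¹ * h x) (hf.const_mul _) (hg.const_mul _)
      (hh.const_mul _) (by rw [← ENNReal.mul_iSup, ENNReal.inv_mul_cancel ha hfa])
      (by rw [← ENNReal.mul_iSup, ENNReal.inv_mul_cancel hb hgb])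
      (fun x => ENNReal.mul_ne_top (by simpa using hc0) (hh1 x)) (by
        intro x y
        rw [mul_pow, ← ENNReal.inv_pow, hc2, ENNReal.mul_inv (Or.inl ha) (Or.inl hfa)]
        calc a⁻¹ * f x * (b⁻¹ * g y) = a⁻¹ * b⁻¹ * (f x * g y) := by ring
          _ ≤ _ := by gcongr; exact H x y)
    rw [lintegral_const_mul _ hf, lintegral_const_mul _ hg, lintegral_const_mul _ hh] at key
    have k2 := (ENNReal.four_mul_le_add_sq (a⁻¹ * ∫⁻ x, f x) (b⁻¹ * ∫⁻ x, g x)).trans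
      (pow_le_pow_left₀ zero_le key 2)
    have e1 : a * b * (a⁻¹ * (∫⁻ x, f x) * (b⁻¹ * ∫⁻ x, g x)) =
        (∫⁻ x, f x) * ∫⁻ x, g x := by
      calc _ = (a * a⁻¹) * (b * b⁻¹) * ((∫⁻ x, f x) * ∫⁻ x, g x) := by ring
        _ = _ := by rw [ENNReal.mul_inv_cancel ha hfa, ENNReal.mul_inv_cancel hb hgb]; simp
    have e2 : a * b * (c⁻¹ * ∫⁻ x, h x) ^ 2 = (∫⁻ x, h x) ^ 2 := by
      rw [← hc2, ← mul_pow, ← mul_assoc, ENNReal.mul_inv_cancel hc0 hct, one_mul]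
    have k3 : (4 : ℝ≥0∞) * (a⁻¹ * (∫⁻ x, f x) * (b⁻¹ * ∫⁻ x, g x)) ≤
        4 * (c⁻¹ * ∫⁻ x, h x) ^ 2 := by
      refine k2.trans (le_of_eq ?_)
      rw [mul_pow]; norm_num
    rw [ENNReal.mul_le_mul_iff_right (by norm_num) (by norm_num)] at k3
    rw [← e1, ← e2]
    gcongr
  intro f g h hf hg hh H
  have hmono : ∀ f : ℝ → ℝ≥0∞, Measurable f →
      ∫⁻ x, f x = ⨆ n : ℕ, ∫⁻ x, min (f x) n := by
    intro f hf
    rw [← lintegral_iSup (fun n => hf.min measurable_const)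
      (fun n m hnm x => min_le_min_left _ (by exact_mod_cast hnm))]
    congr 1; ext x
    rw [← inf_iSup_eq (f := fun n : ℕ => (n : ℝ≥0∞)), ENNReal.iSup_natCast, inf_top_eq]
  suffices hn : ∀ n : ℕ, (∫⁻ x, min (f x) n) * (∫⁻ x, min (g x) n) ≤ (∫⁻ x, h x) ^ 2 by
    rw [hmono f hf, hmono g hg, ENNReal.iSup_mul]
    refine iSup_le fun n => ?_
    rw [ENNReal.mul_iSup]
    refine iSup_le fun m => le_trans ?_ (hn (max n m))
    gcongr <;> simp
  intro n
  have hn : ∀ f : ℝ → ℝ≥0∞, ⨆ x, min (f x) (n : ℝ≥0∞) ≠ ∞ := fun f =>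
    ((iSup_le fun x => min_le_right _ _).trans_lt (ENNReal.natCast_lt_top n)).ne
  refine (bdd _ _ (fun x => min (h x) n) (hf.min measurable_const) (hg.min measurable_const)
    (hh.min measurable_const) (fun x => ((min_le_right _ _).trans_lt
      (ENNReal.natCast_lt_top n)).ne) (hn f) (hn g) ?_).trans ?_
  · intro x y
    -- Truncating all three functions at the same height keeps the hypothesis: where `h` exceeds
    -- `n`, the product of truncations is at most `n²`.
    rcases le_total (h ((2⁻¹ : ℝ) • (x + y))) n with h1 | h1
    · rw [min_eq_left h1]
      exact (mul_le_mul' (min_le_left _ _) (min_le_left _ _)).trans (H x y)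
    · rw [min_eq_right h1, sq]
      exact mul_le_mul' (min_le_right _ _) (min_le_right _ _)
  · gcongr; exact min_le_left _ _

/-- Tensorization: the inequality for `ν` on fibres is exactly the hypothesis of the inequality for
`μ` applied to the marginals. -/
lemma MidpointPrekopaLeindler.prod {E F : Type*} [AddCommGroup E] [Module ℝ E] [MeasurableSpace E]
    [AddCommGroup F] [Module ℝ F] [MeasurableSpace F] {μ : Measure E} {ν : Measure F}
    [SFinite ν] (hμ : MidpointPrekopaLeindler μ) (hν : MidpointPrekopaLeindler ν) :
    MidpointPrekopaLeindler (μ.prod ν) := by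
  intro f g h hf hg hh H
  rw [lintegral_prod _ hf.aemeasurable, lintegral_prod _ hg.aemeasurable,
    lintegral_prod _ hh.aemeasurable]
  refine hμ _ _ _ hf.lintegral_prod_right' hg.lintegral_prod_right' hh.lintegral_prod_right' ?_
  intro x y
  refine hν _ _ _ (hf.comp measurable_prodMk_left) (hg.comp measurable_prodMk_left)
    (hh.comp measurable_prodMk_left) fun a b => ?_
  simpa using H (x, a) (y, b)

lemma MidpointPrekopaLeindler.of_measurePreserving {E F : Type*} [AddCommGroup E] [Module ℝ E]
    [MeasurableSpace E] [AddCommGroup F] [Module ℝ F] [MeasurableSpace F] {μ : Measure E}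
    {ν : Measure F} (hμ : MidpointPrekopaLeindler μ) (e : E → F)
    (he : MeasurePreserving e μ ν)
    (hmid : ∀ x y, e ((2⁻¹ : ℝ) • (x + y)) = (2⁻¹ : ℝ) • (e x + e y)) :
    MidpointPrekopaLeindler ν := by
  intro f g h hf hg hh H
  rw [← he.lintegral_comp hf, ← he.lintegral_comp hg, ← he.lintegral_comp hh]
  refine hμ _ _ _ (hf.comp he.measurable) (hg.comp he.measurable) (hh.comp he.measurable) ?_
  intro x y
  rw [hmid]
  exact H (e x) (e y)

lemma midpointPrekopaLeindler_pi (d : ℕ) :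
    MidpointPrekopaLeindler (volume : Measure (Fin d → ℝ)) := by
  induction d with
  | zero =>
    intro f g h hf hg hh H
    rw [volume_pi, Measure.pi_of_empty (x := 0), lintegral_dirac, lintegral_dirac,
      lintegral_dirac]
    simpa using H 0 0
  | succ d ih =>
    refine MidpointPrekopaLeindler.of_measurePreserving
      (midpointPrekopaLeindler_real.prod ih)
      (MeasurableEquiv.piFinSuccAbove (fun _ : Fin (d + 1) => ℝ) 0).symm
      (volume_preserving_piFinSuccAbove (fun _ : Fin (d + 1) => ℝ) 0).symm ?_
    intro x y
    ext i
    refine Fin.cases ?_ (fun j => ?_) i <;> simp [MeasurableEquiv.piFinSuccAbove, mul_add]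

lemma midpointPrekopaLeindler_euclidean (d : ℕ) :
    MidpointPrekopaLeindler (volume : Measure (Param d)) :=
  (midpointPrekopaLeindler_pi d).of_measurePreserving _ (PiLp.volume_preserving_toLp (Fin d))
    fun x y => by ext; simp [mul_add]

/-! ### The Poincaré inequality for strongly log-concave probability measures -/

lemma integrable_of_abs_le {E : Type*} [MeasurableSpace E] {P : Measure E} [IsFiniteMeasure P]
    {f : E → ℝ} (hf : Measurable f) {B : ℝ} (hB : ∀ x, |f x| ≤ B) : Integrable f P :=
  Integrable.of_bound hf.aestronglyMeasurable B (Eventually.of_forall hB)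

section Poincare

variable {E : Type*} [NormedAddCommGroup E] [NormedSpace ℝ E] [MeasurableSpace E]
  {μ : Measure E} {w φ a : E → ℝ} {ρ A B C : ℝ}

/-- Maurey's transport-type inequality at scale `ε`. -/
lemma integral_exp_mul_integral_exp_neg_le_one (hμ : MidpointPrekopaLeindler μ)
    [IsProbabilityMeasure (μ.withDensity fun x => ENNReal.ofReal (w x))]
    (hw : Measurable w) (hw0 : ∀ x, 0 ≤ w x)
    (hconc : ∀ x y, w x * w y * Real.exp (ρ / 4 * ‖x - y‖ ^ 2) ≤ w ((2⁻¹ : ℝ) • (x + y)) ^ 2)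
    (hφ : Measurable φ) (hφB : ∀ x, |φ x| ≤ B) (ha : Measurable a)
    (hC : ∀ x y, w x ≠ 0 → w y ≠ 0 → φ x - φ y ≤ a x * ‖x - y‖ + C * ‖x - y‖ ^ 2)
    {ε : ℝ} (hε : 0 < ε) (hε' : 0 < ρ - 4 * ε * C) :
    (∫ x, Real.exp (ε * φ x - ε ^ 2 * a x ^ 2 / (ρ - 4 * ε * C))
        ∂(μ.withDensity fun x => ENNReal.ofReal (w x))) *
      (∫ x, Real.exp (-(ε * φ x)) ∂(μ.withDensity fun x => ENNReal.ofReal (w x))) ≤ 1 := by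
  set P := μ.withDensity fun x => ENNReal.ofReal (w x) with hP
  -- The curvature left after the second-order error `ε * C * ‖x - y‖ ^ 2` has been charged to the
  -- Gaussian factor.
  set c := ρ - 4 * ε * C with hc
  have hwm : Measurable fun x => ENNReal.ofReal (w x) := hw.ennreal_ofReal
  have hmF : Measurable fun x => Real.exp (ε * φ x - ε ^ 2 * a x ^ 2 / c) := by fun_prop
  have hmG : Measurable fun x => Real.exp (-(ε * φ x)) := by fun_prop
  have hone : ∫⁻ x, ENNReal.ofReal (w x) ∂μ = 1 := by
    have := measure_univ (μ := P)
    rwa [hP, withDensity_apply _ MeasurableSet.univ, setLIntegral_univ] at this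
  have hF : ∫⁻ x, ENNReal.ofReal (Real.exp (ε * φ x - ε ^ 2 * a x ^ 2 / c)) ∂P =
      ∫⁻ x, ENNReal.ofReal (w x * Real.exp (ε * φ x - ε ^ 2 * a x ^ 2 / c)) ∂μ := by
    rw [hP, lintegral_withDensity_eq_lintegral_mul _ hwm hmF.ennreal_ofReal]
    simp only [Pi.mul_apply, ENNReal.ofReal_mul (hw0 _)]
  have hG : ∫⁻ x, ENNReal.ofReal (Real.exp (-(ε * φ x))) ∂P =
      ∫⁻ x, ENNReal.ofReal (w x * Real.exp (-(ε * φ x))) ∂μ := by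
    rw [hP, lintegral_withDensity_eq_lintegral_mul _ hwm hmG.ennreal_ofReal]
    simp only [Pi.mul_apply, ENNReal.ofReal_mul (hw0 _)]
  have key := hμ _ _ _ (hw.mul hmF).ennreal_ofReal (hw.mul hmG).ennreal_ofReal hwm (by
    intro x y
    simp only [Pi.mul_apply]
    rw [← ENNReal.ofReal_mul (mul_nonneg (hw0 x) (Real.exp_pos _).le), ← ENNReal.ofReal_pow (hw0 _)]
    apply ENNReal.ofReal_le_ofReal
    rcases eq_or_ne (w x) 0 with hx | hx
    · simpa [hx] using sq_nonneg _
    rcases eq_or_ne (w y) 0 with hy | hy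
    · simpa [hy] using sq_nonneg _
    refine le_trans ?_ (hconc x y)
    have e1 : w x * Real.exp (ε * φ x - ε ^ 2 * a x ^ 2 / c) * (w y * Real.exp (-(ε * φ y))) =
        w x * w y * Real.exp (ε * (φ x - φ y) - ε ^ 2 * a x ^ 2 / c) := by
      rw [show ε * (φ x - φ y) - ε ^ 2 * a x ^ 2 / c =
        (ε * φ x - ε ^ 2 * a x ^ 2 / c) + -(ε * φ y) by ring, Real.exp_add]
      ring
    rw [e1]
    refine mul_le_mul_of_nonneg_left (Real.exp_le_exp.2 ?_) (mul_nonneg (hw0 x) (hw0 y))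
    have h1 := mul_le_mul_of_nonneg_left (hC x y hx hy) hε.le
    -- AM–GM: the penalty in the first exponential is the least one that absorbs the linear term
    -- into curvature `c`.
    have h2 : ε * a x * ‖x - y‖ ≤ ε ^ 2 * a x ^ 2 / c + c / 4 * ‖x - y‖ ^ 2 := by
      have : ε ^ 2 * a x ^ 2 / c + c / 4 * ‖x - y‖ ^ 2 - ε * a x * ‖x - y‖ =
          (ε * a x - c / 2 * ‖x - y‖) ^ 2 / c := by
        field_simp; ring
      have : 0 ≤ (ε * a x - c / 2 * ‖x - y‖) ^ 2 / c := by positivity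
      linarith
    have h3 : c / 4 * ‖x - y‖ ^ 2 + ε * C * ‖x - y‖ ^ 2 = ρ / 4 * ‖x - y‖ ^ 2 := by
      rw [hc]; ring
    linarith)
  simp only [Pi.mul_apply] at key
  rw [← hF, ← hG, hone, one_pow] at key
  have b1 : ∀ x, |ε * φ x| ≤ ε * B := fun x => by
    rw [abs_mul, abs_of_pos hε]; exact mul_le_mul_of_nonneg_left (hφB x) hε.le
  have iF : Integrable (fun x => Real.exp (ε * φ x - ε ^ 2 * a x ^ 2 / c)) P := by
    refine integrable_of_abs_le hmF (B := Real.exp (ε * B)) fun x => ?_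
    rw [Real.abs_exp, Real.exp_le_exp]
    have : 0 ≤ ε ^ 2 * a x ^ 2 / c := by positivity
    linarith [(abs_le.1 (b1 x)).2]
  have iG : Integrable (fun x => Real.exp (-(ε * φ x))) P := by
    refine integrable_of_abs_le hmG (B := Real.exp (ε * B)) fun x => ?_
    rw [Real.abs_exp, Real.exp_le_exp]
    linarith [(abs_le.1 (b1 x)).1]
  rw [← ofReal_integral_eq_lintegral_ofReal iF (Eventually.of_forall fun x => (Real.exp_pos _).le),
    ← ofReal_integral_eq_lintegral_ofReal iG (Eventually.of_forall fun x => (Real.exp_pos _).le),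
    ← ENNReal.ofReal_mul (integral_nonneg fun x => (Real.exp_pos _).le)] at key
  simpa using key

lemma exp_ge_quadratic_sub_cube {u : ℝ} (hu : |u| ≤ 1) :
    1 + u + u ^ 2 / 2 - |u| ^ 3 ≤ Real.exp u := by
  have h := Real.exp_bound hu (n := 3) (by norm_num)
  simp [Finset.sum_range_succ, Nat.factorial] at h
  have h1 := (abs_le.1 h).1
  have : 0 ≤ |u| ^ 3 := by positivity
  norm_num at h1
  nlinarith

/-- Maurey's inequality is expanded as `ε → 0`. Since `φ` is centred, both exponential integrals are
`1 + ε² v / 2` up to `ε³`, while the penalty lowers the first factor by about `ε² α / ρ`. Comparing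
the `ε²` terms gives `v ≤ α / ρ`. -/
lemma integral_sq_le_of_integral_eq_zero (hμ : MidpointPrekopaLeindler μ)
    [IsProbabilityMeasure (μ.withDensity fun x => ENNReal.ofReal (w x))]
    (hw : Measurable w) (hw0 : ∀ x, 0 ≤ w x) (hρ : 0 < ρ)
    (hconc : ∀ x y, w x * w y * Real.exp (ρ / 4 * ‖x - y‖ ^ 2) ≤ w ((2⁻¹ : ℝ) • (x + y)) ^ 2)
    (hφ : Measurable φ) (hφB : ∀ x, |φ x| ≤ B) (ha : Measurable a) (haA : ∀ x, |a x| ≤ A)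
    (hC : ∀ x y, w x ≠ 0 → w y ≠ 0 → φ x - φ y ≤ a x * ‖x - y‖ + C * ‖x - y‖ ^ 2)
    (hmean : ∫ x, φ x ∂(μ.withDensity fun x => ENNReal.ofReal (w x)) = 0) :
    ∫ x, φ x ^ 2 ∂(μ.withDensity fun x => ENNReal.ofReal (w x)) ≤
      (∫ x, a x ^ 2 ∂(μ.withDensity fun x => ENNReal.ofReal (w x))) / ρ := by
  set P := μ.withDensity fun x => ENNReal.ofReal (w x) with hP
  have hne : Nonempty E := by
    by_contra h
    rw [not_nonempty_iff] at h
    simpa [Measure.eq_zero_of_isEmpty] using measure_univ (μ := P)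
  have hB : 0 ≤ B := (abs_nonneg _).trans (hφB hne.some)
  set v := ∫ x, φ x ^ 2 ∂P with hv
  set α := ∫ x, a x ^ 2 ∂P with hα
  have hφi : Integrable φ P := integrable_of_abs_le hφ hφB
  have hφ2i : Integrable (fun x => φ x ^ 2) P := by
    refine integrable_of_abs_le (hφ.pow_const 2) (B := B ^ 2) fun x => ?_
    rw [abs_pow]; exact pow_le_pow_left₀ (abs_nonneg _) (hφB x) 2
  have ha2i : Integrable (fun x => a x ^ 2) P := by
    refine integrable_of_abs_le (ha.pow_const 2) (B := A ^ 2) fun x => ?_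
    rw [abs_pow]; exact pow_le_pow_left₀ (abs_nonneg _) (haA x) 2
  have hexpi : ∀ s : ℝ, Integrable (fun x => Real.exp (s * φ x)) P := fun s => by
    refine integrable_of_abs_le (by fun_prop) (B := Real.exp (|s| * B)) fun x => ?_
    rw [Real.abs_exp, Real.exp_le_exp]
    refine (le_abs_self _).trans ?_
    rw [abs_mul]
    exact mul_le_mul_of_nonneg_left (hφB x) (abs_nonneg s)
  have hlow : ∀ s : ℝ, |s| * B ≤ 1 →
      1 + s ^ 2 * v / 2 - |s| ^ 3 * B ^ 3 ≤ ∫ x, Real.exp (s * φ x) ∂P := fun s hs => by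
    have e : ∫ x, (1 + s * φ x + s ^ 2 / 2 * φ x ^ 2 - |s| ^ 3 * B ^ 3) ∂P =
        1 + s ^ 2 * v / 2 - |s| ^ 3 * B ^ 3 := by
      have i1 : Integrable (fun x => 1 + s * φ x) P := (integrable_const _).add (hφi.const_mul _)
      have i2 : Integrable (fun x => 1 + s * φ x + s ^ 2 / 2 * φ x ^ 2) P :=
        i1.add (hφ2i.const_mul _)
      rw [integral_sub i2 (integrable_const _), integral_add i1 (hφ2i.const_mul _),
        integral_add (integrable_const _) (hφi.const_mul _), integral_const_mul, integral_const_mul, hmean]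
      simp
      ring
    rw [← e]
    refine integral_mono (((((integrable_const _).add (hφi.const_mul _)).add
      (hφ2i.const_mul _))).sub (integrable_const _)) (hexpi s) fun x => ?_
    have hb : |s * φ x| ≤ |s| * B := by
      rw [abs_mul]; exact mul_le_mul_of_nonneg_left (hφB x) (abs_nonneg s)
    have h1 := exp_ge_quadratic_sub_cube (hb.trans hs)
    have h2 : |s * φ x| ^ 3 ≤ |s| ^ 3 * B ^ 3 := by
      rw [← mul_pow]; exact pow_le_pow_left₀ (abs_nonneg _) hb 3
    simp only
    nlinarith
  have main : ∀ᶠ ε in 𝓝[>] (0 : ℝ),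
      v - 2 * ε * B ^ 3 ≤ α * Real.exp (ε * B) ^ 2 / (ρ - 4 * ε * C) := by
    have c1 : ∀ᶠ ε in 𝓝[>] (0 : ℝ), 0 < ρ - 4 * ε * C := by
      apply eventually_nhdsWithin_of_eventually_nhds
      have : ContinuousAt (fun ε : ℝ => ρ - 4 * ε * C) 0 := by fun_prop
      exact this.eventually (lt_mem_nhds (by simpa using hρ))
    have c2 : ∀ᶠ ε in 𝓝[>] (0 : ℝ), ε * B < 1 := by
      apply eventually_nhdsWithin_of_eventually_nhds
      have : ContinuousAt (fun ε : ℝ => ε * B) 0 := by fun_prop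
      exact this.eventually (gt_mem_nhds (by simp))
    have c3 : ∀ᶠ ε in 𝓝[>] (0 : ℝ), 0 < 1 + ε ^ 2 * v / 2 - ε ^ 3 * B ^ 3 := by
      apply eventually_nhdsWithin_of_eventually_nhds
      have : ContinuousAt (fun ε : ℝ => 1 + ε ^ 2 * v / 2 - ε ^ 3 * B ^ 3) 0 := by fun_prop
      exact this.eventually (lt_mem_nhds (by simp))
    filter_upwards [c1, c2, c3, self_mem_nhdsWithin] with ε hc hεB hp hε
    rw [Set.mem_Ioi] at hε
    have key := integral_exp_mul_integral_exp_neg_le_one hμ hw hw0 hconc hφ hφB ha hC hε hc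
    rw [← hP] at key
    set c := ρ - 4 * ε * C
    set p := ε ^ 2 * v / 2 - ε ^ 3 * B ^ 3 with hpdef
    set q := ε ^ 2 * α * Real.exp (ε * B) / c with hq
    set X := ∫ x, Real.exp (ε * φ x) ∂P
    set Y := ∫ x, Real.exp (-(ε * φ x)) ∂P
    have hX : 1 + p ≤ X := by
      have := hlow ε (by rw [abs_of_pos hε]; exact hεB.le)
      rw [abs_of_pos hε] at this
      linarith
    have hY : 1 + p ≤ Y := by
      have := hlow (-ε) (by rw [abs_neg, abs_of_pos hε]; exact hεB.le)
      rw [abs_neg, abs_of_pos hε] at this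
      simp only [neg_mul, neg_sq] at this
      linarith
    have hφb : ∀ x, |ε * φ x| ≤ ε * B := fun x => by
      rw [abs_mul, abs_of_pos hε]; exact mul_le_mul_of_nonneg_left (hφB x) hε.le
    -- This crude bound suffices: it tends to `1` and only multiplies `q`, which is already of order
    -- `ε²`.
    have hYle : Y ≤ Real.exp (ε * B) := by
      have : Y ≤ ∫ _, Real.exp (ε * B) ∂P := by
        refine integral_mono (by simpa using hexpi (-ε)) (integrable_const _) fun x => ?_
        simp only [Real.exp_le_exp]
        linarith [(abs_le.1 (hφb x)).1]
      simpa using this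
    have hZ : X - q ≤ ∫ x, Real.exp (ε * φ x - ε ^ 2 * a x ^ 2 / c) ∂P := by
      have e : ∫ x, (Real.exp (ε * φ x) - ε ^ 2 * Real.exp (ε * B) / c * a x ^ 2) ∂P = X - q := by
        rw [integral_sub (hexpi ε) (ha2i.const_mul _), integral_const_mul, hq]
        ring
      rw [← e]
      refine integral_mono ((hexpi ε).sub (ha2i.const_mul _)) ?_ fun x => ?_
      · refine integrable_of_abs_le (by fun_prop) (B := Real.exp (ε * B)) fun x => ?_
        rw [Real.abs_exp, Real.exp_le_exp]
        have : 0 ≤ ε ^ 2 * a x ^ 2 / c := by positivity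
        linarith [(abs_le.1 (hφb x)).2]
      · simp only
        set t := ε ^ 2 * a x ^ 2 / c with ht
        have ht0 : 0 ≤ t := by positivity
        have e2 : ε ^ 2 * Real.exp (ε * B) / c * a x ^ 2 = t * Real.exp (ε * B) := by
          rw [ht]; ring
        rw [e2, sub_eq_add_neg _ t, Real.exp_add]
        have h1 := Real.add_one_le_exp (-t)
        have h2 : Real.exp (ε * φ x) ≤ Real.exp (ε * B) :=
          Real.exp_le_exp.2 (abs_le.1 (hφb x)).2
        have h3 := mul_le_mul_of_nonneg_left h1 (Real.exp_pos (ε * φ x)).le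
        have h4 := mul_le_mul_of_nonneg_left h2 ht0
        linarith
    have hY0 : 0 ≤ Y := integral_nonneg fun x => (Real.exp_pos _).le
    have hα0 : 0 ≤ α := integral_nonneg fun x => sq_nonneg _
    have hq0 : 0 ≤ q := by positivity
    have h1 : (X - q) * Y ≤ 1 := (mul_le_mul_of_nonneg_right hZ hY0).trans key
    have h2 : (1 + p) * (1 + p) ≤ X * Y :=
      mul_le_mul hX hY (by rw [hpdef]; linarith) (by rw [hpdef] at hX; linarith)
    have h3 : q * Y ≤ q * Real.exp (ε * B) := mul_le_mul_of_nonneg_left hYle hq0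
    have h4 : 2 * p ≤ q * Real.exp (ε * B) := by nlinarith [sq_nonneg p]
    have h5 : q * Real.exp (ε * B) = ε ^ 2 * (α * Real.exp (ε * B) ^ 2 / c) := by
      rw [hq]; ring
    have h6 : 2 * p = ε ^ 2 * (v - 2 * ε * B ^ 3) := by rw [hpdef]; ring
    rw [h5, h6] at h4
    exact le_of_mul_le_mul_left h4 (by positivity)
  have l1 : Tendsto (fun ε : ℝ => v - 2 * ε * B ^ 3) (𝓝[>] 0) (𝓝 v) := by
    have : ContinuousAt (fun ε : ℝ => v - 2 * ε * B ^ 3) 0 := by fun_prop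
    simpa using this.tendsto.mono_left (nhdsWithin_le_nhds (s := Set.Ioi 0))
  have l2 : Tendsto (fun ε : ℝ => α * Real.exp (ε * B) ^ 2 / (ρ - 4 * ε * C)) (𝓝[>] 0)
      (𝓝 (α / ρ)) := by
    have : ContinuousAt (fun ε : ℝ => α * Real.exp (ε * B) ^ 2 / (ρ - 4 * ε * C)) 0 := by
      refine ContinuousAt.div (by fun_prop) (by fun_prop) (by simpa using hρ.ne')
    simpa using this.tendsto.mono_left (nhdsWithin_le_nhds (s := Set.Ioi 0))
  exact le_of_tendsto_of_tendsto l1 l2 main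

/-- The Poincaré inequality for a strongly log-concave probability density `w`: here `a` is an
upper gradient of `φ`, up to second order. -/
theorem integral_sq_sub_sq_integral_le (hμ : MidpointPrekopaLeindler μ)
    [IsProbabilityMeasure (μ.withDensity fun x => ENNReal.ofReal (w x))]
    (hw : Measurable w) (hw0 : ∀ x, 0 ≤ w x) (hρ : 0 < ρ)
    (hconc : ∀ x y, w x * w y * Real.exp (ρ / 4 * ‖x - y‖ ^ 2) ≤ w ((2⁻¹ : ℝ) • (x + y)) ^ 2)
    (hφ : Measurable φ) (hφB : ∀ x, |φ x| ≤ B) (ha : Measurable a) (haA : ∀ x, |a x| ≤ A)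
    (hC : ∀ x y, w x ≠ 0 → w y ≠ 0 → φ x - φ y ≤ a x * ‖x - y‖ + C * ‖x - y‖ ^ 2) :
    ∫ x, φ x ^ 2 ∂(μ.withDensity fun x => ENNReal.ofReal (w x)) -
        (∫ x, φ x ∂(μ.withDensity fun x => ENNReal.ofReal (w x))) ^ 2 ≤
      (∫ x, a x ^ 2 ∂(μ.withDensity fun x => ENNReal.ofReal (w x))) / ρ := by
  set P := μ.withDensity fun x => ENNReal.ofReal (w x) with hP
  set m := ∫ x, φ x ∂P with hm
  have hφi : Integrable φ P := integrable_of_abs_le hφ hφB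
  have hφ2i : Integrable (fun x => φ x ^ 2) P := by
    refine integrable_of_abs_le (hφ.pow_const 2) (B := B ^ 2) fun x => ?_
    rw [abs_pow]; exact pow_le_pow_left₀ (abs_nonneg _) (hφB x) 2
  have key := integral_sq_le_of_integral_eq_zero (φ := fun x => φ x - m) (B := B + |m|) (C := C)
    hμ hw hw0 hρ hconc (hφ.sub_const m)
    (fun x => (abs_sub _ _).trans (by gcongr; exact hφB x)) ha haA
    (fun x y hx hy => by simpa using hC x y hx hy)
    (by rw [← hP, integral_sub hφi (integrable_const _)]; simp [hm])
  rw [← hP] at key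
  refine le_trans (le_of_eq ?_) key
  have e : ∀ x, (φ x - m) ^ 2 = φ x ^ 2 - 2 * m * φ x + m ^ 2 := fun x => by ring
  simp only [e]
  have i1 : Integrable (fun x => φ x ^ 2 - 2 * m * φ x) P := hφ2i.sub (hφi.const_mul _)
  rw [integral_add i1 (integrable_const _),
    integral_sub hφ2i (hφi.const_mul _), integral_const_mul, ← hm]
  simp
  ring

end Poincare

/-! ### Comparison of two Gibbs measures on a convex set -/

/-- Zero mean makes the integrals over `A` and its complement opposite, so each is at most half of
the `L¹` norm. -/
lemma two_mul_abs_setIntegral_le {Ω : Type*} [MeasurableSpace Ω] {P : Measure Ω} {h : Ω → ℝ}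
    (hh : Integrable h P) (h0 : ∫ x, h x ∂P = 0) {A : Set Ω} (hA : MeasurableSet A) :
    2 * |∫ x in A, h x ∂P| ≤ ∫ x, |h x| ∂P := by
  have e1 := integral_add_compl hA hh
  have e2 := integral_add_compl hA hh.abs
  have h1 := abs_integral_le_integral_abs (μ := P.restrict A) (f := h)
  have h2 := abs_integral_le_integral_abs (μ := P.restrict Aᶜ) (f := h)
  have e3 : ∫ x in Aᶜ, h x ∂P = -∫ x in A, h x ∂P := by linarith
  rw [e3, abs_neg] at h2
  linarith

/-- Le Cam's bound of the total variation distance by the Hellinger affinity. -/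
lemma abs_setIntegral_sq_sub_le {Ω : Type*} [MeasurableSpace Ω] {P : Measure Ω}
    [IsProbabilityMeasure P] {φ : Ω → ℝ} (hφ : Measurable φ) {B : ℝ} (hB : ∀ x, |φ x| ≤ B)
    (hφ0 : ∀ x, 0 ≤ φ x) (hone : ∫ x, φ x ^ 2 ∂P = 1) {A : Set Ω} (hA : MeasurableSet A) :
    |∫ x in A, φ x ^ 2 ∂P - P.real A| ≤ √(∫ x, φ x ^ 2 ∂P - (∫ x, φ x ∂P) ^ 2) := by
  have hφi : Integrable φ P := integrable_of_abs_le hφ hB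
  have hφ2i : Integrable (fun x => φ x ^ 2) P := by
    refine integrable_of_abs_le (hφ.pow_const 2) (B := B ^ 2) fun x => ?_
    rw [abs_pow]; exact pow_le_pow_left₀ (abs_nonneg _) (hB x) 2
  set m := ∫ x, φ x ∂P with hm
  have hm0 : 0 ≤ m := integral_nonneg hφ0
  have hi : Integrable (fun x => φ x ^ 2 - 1) P := hφ2i.sub (integrable_const _)
  have e0 : ∫ x, (φ x ^ 2 - 1) ∂P = 0 := by
    rw [integral_sub hφ2i (integrable_const _), hone]; simp
  have e1 : ∫ x in A, φ x ^ 2 ∂P - P.real A = ∫ x in A, (φ x ^ 2 - 1) ∂P := by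
    rw [integral_sub hφ2i.integrableOn (integrable_const _)]; simp
  have h1 := two_mul_abs_setIntegral_le hi e0 hA
  rw [← e1] at h1
  set I := ∫ x, |φ x ^ 2 - 1| ∂P with hI
  have hI0 : 0 ≤ I := integral_nonneg fun x => abs_nonneg _
  -- Cauchy–Schwarz for `|φ² - 1| = |φ - 1| |φ + 1|`, through the nonnegative quadratic `∫ (|φ - 1|
  -- - t |φ + 1|)²`. The outer coefficients are `∫ (φ - 1)² = 2 - 2m` and `∫ (φ + 1)² = 2 + 2m`.
  have key : ∀ t : ℝ, 0 ≤ (2 - 2 * m) - 2 * t * I + t ^ 2 * (2 + 2 * m) := fun t => by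
    have e : ∫ x, ((1 + t ^ 2) * φ x ^ 2 + ((2 * t ^ 2 - 2) * φ x + (1 + t ^ 2)) -
        2 * t * |φ x ^ 2 - 1|) ∂P = (2 - 2 * m) - 2 * t * I + t ^ 2 * (2 + 2 * m) := by
      have i1 : Integrable (fun x => (2 * t ^ 2 - 2) * φ x + (1 + t ^ 2)) P :=
        (hφi.const_mul _).add (integrable_const _)
      have i2 : Integrable (fun x => (1 + t ^ 2) * φ x ^ 2 +
          ((2 * t ^ 2 - 2) * φ x + (1 + t ^ 2))) P := (hφ2i.const_mul _).add i1
      rw [integral_sub i2 (hi.abs.const_mul _), integral_add (hφ2i.const_mul _) i1,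
        integral_add (hφi.const_mul _) (integrable_const _), integral_const_mul,
        integral_const_mul, integral_const_mul, hone, ← hm, ← hI]
      simp
      ring
    rw [← e]
    refine integral_nonneg fun x => ?_
    have : (1 + t ^ 2) * φ x ^ 2 + ((2 * t ^ 2 - 2) * φ x + (1 + t ^ 2)) -
        2 * t * |φ x ^ 2 - 1| = (|φ x - 1| - t * |φ x + 1|) ^ 2 := by
      rw [show φ x ^ 2 - 1 = (φ x - 1) * (φ x + 1) by ring, abs_mul, sub_sq, mul_pow, sq_abs,
        sq_abs]
      ring
    simp only [Pi.zero_apply, this]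
    positivity
  have hI2 : I ^ 2 ≤ (2 - 2 * m) * (2 + 2 * m) := by
    have hb : 0 < 2 + 2 * m := by linarith
    have := key (I / (2 + 2 * m))
    have e2 : (2 - 2 * m) - 2 * (I / (2 + 2 * m)) * I + (I / (2 + 2 * m)) ^ 2 * (2 + 2 * m) =
        ((2 - 2 * m) * (2 + 2 * m) - I ^ 2) / (2 + 2 * m) := by
      field_simp; ring
    rw [e2] at this
    have := mul_nonneg this hb.le
    rw [div_mul_cancel₀ _ hb.ne'] at this
    linarith
  rw [hone]
  apply Real.le_sqrt_of_sq_le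
  have := pow_le_pow_left₀ (by positivity) h1 2
  nlinarith

lemma integral_withDensity_ofReal {E : Type*} [MeasurableSpace E] {μ : Measure E} {w : E → ℝ}
    (hw : Measurable w) (hw0 : ∀ x, 0 ≤ w x) (f : E → ℝ) :
    ∫ x, f x ∂(μ.withDensity fun x => ENNReal.ofReal (w x)) = ∫ x, w x * f x ∂μ := by
  rw [integral_withDensity_eq_integral_toReal_smul hw.ennreal_ofReal
    (Eventually.of_forall fun x => ENNReal.ofReal_lt_top)]
  simp only [ENNReal.toReal_ofReal (hw0 _), smul_eq_mul]

/-- With `φ` the square root of the density of the `W`-measure relative to the `V`-measure, total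
variation is at most the standard deviation of `φ`, which Poincaré bounds by its gradient `φ b / 2`.
Squaring turns the weight `φ²` back into the `W`-measure. Only `V` has to be convex, and `C` leaves
no trace in the bound. -/
theorem abs_gibbs_sub_gibbs_le {E : Type*} [NormedAddCommGroup E] [NormedSpace ℝ E]
    [MeasurableSpace E] {μ : Measure E} (hμ : MidpointPrekopaLeindler μ) {K : Set E}
    (hK : MeasurableSet K) (hKc : Convex ℝ K) (hK0 : μ K ≠ 0) (hKt : μ K ≠ ∞) {V W b : E → ℝ}
    (hV : Measurable V) (hW : Measurable W) (hb : Measurable b) {ρ B A C : ℝ} (hρ : 0 < ρ)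
    (hC : 0 ≤ C) (hVB : ∀ x ∈ K, |V x| ≤ B) (hWB : ∀ x ∈ K, |W x| ≤ B)
    (hbA : ∀ x ∈ K, |b x| ≤ A)
    (hconc : ∀ x ∈ K, ∀ y ∈ K,
      2 * V ((2⁻¹ : ℝ) • (x + y)) + ρ / 4 * ‖x - y‖ ^ 2 ≤ V x + V y)
    (hgrad : ∀ x ∈ K, ∀ y ∈ K,
      (V x - W x) - (V y - W y) ≤ b x * ‖x - y‖ + C * ‖x - y‖ ^ 2)
    {S : Set E} (hS : MeasurableSet S) :
    |(∫ x in S ∩ K, Real.exp (-W x) ∂μ) / (∫ x in K, Real.exp (-W x) ∂μ) -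
      (∫ x in S ∩ K, Real.exp (-V x) ∂μ) / (∫ x in K, Real.exp (-V x) ∂μ)| ≤
    √((∫ x in K, b x ^ 2 * Real.exp (-W x) ∂μ) / (∫ x in K, Real.exp (-W x) ∂μ) / (4 * ρ)) := by
  have : IsFiniteMeasure (μ.restrict K) := ⟨by simpa using hKt.lt_top⟩
  have : NeZero (μ.restrict K) := ⟨by simpa using hK0⟩
  have hexp : ∀ U : E → ℝ, Measurable U → (∀ x ∈ K, |U x| ≤ B) →
      IntegrableOn (fun x => Real.exp (-U x)) K μ ∧ 0 < ∫ x in K, Real.exp (-U x) ∂μ := by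
    intro U hU hUB
    have i : IntegrableOn (fun x => Real.exp (-U x)) K μ := by
      refine Integrable.of_bound (by fun_prop) (Real.exp B) ?_
      filter_upwards [ae_restrict_mem hK] with x hx
      rw [Real.norm_eq_abs, Real.abs_exp, Real.exp_le_exp]
      linarith [(abs_le.1 (hUB x hx)).1]
    exact ⟨i, integral_exp_pos i⟩
  obtain ⟨iV, pV⟩ := hexp V hV hVB
  obtain ⟨iW, pW⟩ := hexp W hW hWB
  set ZV := ∫ x in K, Real.exp (-V x) ∂μ with hZV
  set ZW := ∫ x in K, Real.exp (-W x) ∂μ with hZW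
  -- This factor makes `φ²` have mean one.
  set s := √(ZV / ZW) with hs
  have hs2 : s ^ 2 = ZV / ZW := Real.sq_sqrt (by positivity)
  have hs0 : 0 < s := Real.sqrt_pos.2 (by positivity)
  set w : E → ℝ := K.indicator fun x => Real.exp (-V x) / ZV with hw
  set φ : E → ℝ := K.indicator fun x => s * Real.exp ((V x - W x) / 2) with hφ
  set a : E → ℝ := K.indicator fun x => φ x * b x / 2 with ha
  have mw : Measurable w := Measurable.indicator (by fun_prop) hK
  have mφ : Measurable φ := Measurable.indicator (by fun_prop) hK
  have ma : Measurable a := Measurable.indicator (by fun_prop) hK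
  have w0 : ∀ x, 0 ≤ w x := fun x => Set.indicator_nonneg (fun x _ => by positivity) x
  have φ0 : ∀ x, 0 ≤ φ x := fun x => Set.indicator_nonneg (fun x _ => by positivity) x
  have wK : ∀ x ∈ K, w x = Real.exp (-V x) / ZV := fun x hx => by
    rw [hw, Set.indicator_of_mem hx]
  have φK : ∀ x ∈ K, φ x = s * Real.exp ((V x - W x) / 2) := fun x hx => by
    rw [hφ, Set.indicator_of_mem hx]
  have aK : ∀ x ∈ K, a x = φ x * b x / 2 := fun x hx => by rw [ha, Set.indicator_of_mem hx]
  have w_ne : ∀ x, w x ≠ 0 → x ∈ K := fun x hx => Set.mem_of_indicator_ne_zero hx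
  have φB : ∀ x, |φ x| ≤ s * Real.exp B := fun x => by
    rw [abs_of_nonneg (φ0 x)]
    by_cases hx : x ∈ K
    · rw [φK x hx]
      gcongr
      linarith [(abs_le.1 (hVB x hx)).2, (abs_le.1 (hWB x hx)).1]
    · rw [hφ, Set.indicator_of_notMem hx]; positivity
  have aA : ∀ x, |a x| ≤ s * Real.exp B * |A| / 2 := fun x => by
    by_cases hx : x ∈ K
    · rw [aK x hx, abs_div, abs_mul, abs_two]
      have := mul_le_mul (φB x) ((hbA x hx).trans (le_abs_self A)) (abs_nonneg _)
        (by positivity)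
      linarith
    · rw [ha, Set.indicator_of_notMem hx, abs_zero]; positivity
  set P := μ.withDensity fun x => ENNReal.ofReal (w x) with hP
  have intP : ∀ f : E → ℝ, ∫ x, f x ∂P = (∫ x in K, f x * Real.exp (-V x) ∂μ) / ZV := fun f => by
    rw [hP, integral_withDensity_ofReal mw w0, ← integral_div,
      ← integral_indicator hK]
    congr 1; ext x
    by_cases hx : x ∈ K
    · rw [Set.indicator_of_mem hx, wK x hx]; ring
    · rw [Set.indicator_of_notMem hx, hw, Set.indicator_of_notMem hx, zero_mul]
  have : IsProbabilityMeasure P := ⟨by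
    rw [hP, withDensity_apply _ MeasurableSet.univ, setLIntegral_univ,
      ← ofReal_integral_eq_lintegral_ofReal _ (Eventually.of_forall w0), hw, integral_indicator hK,
      integral_div, ← hZV, div_self pV.ne', ENNReal.ofReal_one]
    exact (integrable_indicator_iff hK).2 (Integrable.div_const iV ZV)⟩
  have φsq : ∀ x ∈ K, φ x ^ 2 * Real.exp (-V x) = ZV / ZW * Real.exp (-W x) := fun x hx => by
    rw [φK x hx, mul_pow, hs2, ← Real.exp_nat_mul, mul_assoc, ← Real.exp_add]
    congr 2; push_cast; ring
  have e1 : ∀ S : Set E, MeasurableSet S → ∫ x in S, φ x ^ 2 ∂P =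
      (∫ x in S ∩ K, Real.exp (-W x) ∂μ) / ZW := fun S hS => by
    rw [← integral_indicator hS, intP, Set.inter_comm, ← setIntegral_indicator hS]
    rw [div_eq_div_iff pV.ne' pW.ne', ← integral_mul_const, ← integral_mul_const]
    refine setIntegral_congr_fun hK fun x hx => ?_
    by_cases hxS : x ∈ S
    · simp only [Set.indicator_of_mem hxS]
      rw [φsq x hx]
      field_simp
    · simp only [Set.indicator_of_notMem hxS, zero_mul]
  have e2 : P.real S = (∫ x in S ∩ K, Real.exp (-V x) ∂μ) / ZV := by
    rw [← integral_indicator_one hS, intP, Set.inter_comm, ← setIntegral_indicator hS]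
    congr 1
    refine setIntegral_congr_fun hK fun x hx => ?_
    by_cases hxS : x ∈ S
    · simp [Set.indicator_of_mem hxS]
    · simp [Set.indicator_of_notMem hxS]
  have hone : ∫ x, φ x ^ 2 ∂P = 1 := by
    rw [← setIntegral_univ, e1 _ MeasurableSet.univ, Set.univ_inter, ← hZW, div_self pW.ne']
  have e3 : ∫ x, a x ^ 2 ∂P = (∫ x in K, b x ^ 2 * Real.exp (-W x) ∂μ) / ZW / 4 := by
    rw [intP, div_div, div_eq_div_iff pV.ne' (by positivity),
      ← integral_mul_const (ZW * 4), ← integral_mul_const ZV]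
    refine setIntegral_congr_fun hK fun x hx => ?_
    rw [aK x hx, div_pow, mul_pow]
    rw [show φ x ^ 2 * b x ^ 2 / 2 ^ 2 * Real.exp (-V x) * (ZW * 4) =
      (φ x ^ 2 * Real.exp (-V x)) * b x ^ 2 * ZW by ring, φsq x hx]
    field_simp
  have hm := abs_setIntegral_sq_sub_le mφ φB φ0 hone hS
  rw [e1 S hS, e2] at hm
  refine hm.trans (Real.sqrt_le_sqrt ?_)
  rw [show (∫ x in K, b x ^ 2 * Real.exp (-W x) ∂μ) / ZW / (4 * ρ) =
    (∫ x, a x ^ 2 ∂P) / ρ by rw [e3]; field_simp]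
  refine integral_sq_sub_sq_integral_le (C := s * Real.exp B * C / 2) hμ mw w0 hρ ?_ mφ φB ma aA ?_
  · intro x y
    by_cases hx : x ∈ K
    swap
    · rw [hw, Set.indicator_of_notMem hx]; simpa using sq_nonneg _
    by_cases hy : y ∈ K
    swap
    · rw [hw, Set.indicator_of_notMem hy]; simpa using sq_nonneg _
    have hxy : (2⁻¹ : ℝ) • (x + y) ∈ K := by
      rw [smul_add]
      exact hKc hx hy (by norm_num) (by norm_num) (by norm_num)
    rw [wK x hx, wK y hy, wK _ hxy]
    rw [show Real.exp (-V x) / ZV * (Real.exp (-V y) / ZV) * Real.exp (ρ / 4 * ‖x - y‖ ^ 2) =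
      (Real.exp (-V x) * Real.exp (-V y) * Real.exp (ρ / 4 * ‖x - y‖ ^ 2)) / ZV ^ 2 by ring,
      div_pow, ← Real.exp_add, ← Real.exp_add, ← Real.exp_nat_mul]
    gcongr
    push_cast
    linarith [hconc x hx y hy]
  · intro x y hx hy
    replace hx := w_ne x hx
    replace hy := w_ne y hy
    have h1 := hgrad x hx y hy
    -- The tangent line of `exp` at `x`: convexity alone turns the increment bound on `V - W` into
    -- one for `φ`, with `φ x` as coefficient.
    have h2 : φ x * (1 + ((V y - W y) / 2 - (V x - W x) / 2)) ≤ φ y := by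
      rw [φK x hx, φK y hy, mul_assoc]
      refine mul_le_mul_of_nonneg_left ?_ hs0.le
      have := mul_le_mul_of_nonneg_left
        (Real.add_one_le_exp ((V y - W y) / 2 - (V x - W x) / 2))
        (Real.exp_pos ((V x - W x) / 2)).le
      rw [← Real.exp_add, add_sub_cancel] at this
      linarith
    have h3 := mul_le_mul_of_nonneg_left h1 (φ0 x)
    have h4 : φ x * (C * ‖x - y‖ ^ 2) ≤ s * Real.exp B * (C * ‖x - y‖ ^ 2) :=
      mul_le_mul_of_nonneg_right ((le_abs_self _).trans (φB x)) (by positivity)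
    rw [aK x hx]
    nlinarith

/-! ### Centred Gaussian measures -/

/-- The quadratic form `xᵀ A x` of a matrix. -/
def quadForm {d : ℕ} (A : Matrix (Fin d) (Fin d) ℝ) (x : Param d) : ℝ :=
  inner ℝ x (Matrix.toEuclideanCLM (n := Fin d) (𝕜 := ℝ) A x)

lemma measurable_quadForm {d : ℕ} (A : Matrix (Fin d) (Fin d) ℝ) :
    Measurable (quadForm A) := by
  unfold quadForm; fun_prop

/-- The two finite measures have the same characteristic function. -/
lemma stdGaussian_eq_withDensity (d : ℕ) :
    stdGaussian (Param d) = (volume : Measure (Param d)).withDensity fun x =>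
      ENNReal.ofReal (((2 * Real.pi) ^ ((d : ℝ) / 2))⁻¹ * Real.exp (-(‖x‖ ^ 2 / 2))) := by
  have hm : Measurable fun x : Param d =>
      ((2 * Real.pi) ^ ((d : ℝ) / 2))⁻¹ * Real.exp (-(‖x‖ ^ 2 / 2)) := by fun_prop
  have hi0 : Integrable fun x : Param d => Real.exp (-(‖x‖ ^ 2 / 2)) := by
    have := GaussianFourier.integrable_cexp_neg_mul_sq_norm_add (V := Param d) (b := 1 / 2) (by norm_num) 0 0
    refine (this.norm).congr (Eventually.of_forall fun x => ?_)
    simp only [Complex.norm_exp]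
    congr 1
    rw [show -(1 / 2 : ℂ) * (‖x‖ : ℂ) ^ 2 + 0 * ((inner ℝ (0 : Param d) x : ℝ) : ℂ) =
      ((-(‖x‖ ^ 2 / 2) : ℝ) : ℂ) by push_cast; ring, Complex.ofReal_re]
  have hfin : IsFiniteMeasure ((volume : Measure (Param d)).withDensity fun x =>
      ENNReal.ofReal (((2 * Real.pi) ^ ((d : ℝ) / 2))⁻¹ * Real.exp (-(‖x‖ ^ 2 / 2)))) :=
    isFiniteMeasure_withDensity_ofReal (hi0.const_mul _).2
  apply Measure.ext_of_charFun
  ext t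
  rw [charFun_stdGaussian, charFun_apply,
    integral_withDensity_eq_integral_toReal_smul hm.ennreal_ofReal
      (Eventually.of_forall fun x => ENNReal.ofReal_lt_top)]
  have key := GaussianFourier.integral_cexp_neg_mul_sq_norm_add (V := Param d) (b := 1 / 2) (by norm_num)
    Complex.I t
  have hpos : (0 : ℝ) < (2 * Real.pi) ^ ((d : ℝ) / 2) := by positivity
  have e1 : ∀ x : Param d, (ENNReal.ofReal (((2 * Real.pi) ^ ((d : ℝ) / 2))⁻¹ *
      Real.exp (-(‖x‖ ^ 2 / 2)))).toReal • Complex.exp ((inner ℝ x t : ℝ) * Complex.I) =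
      (((2 * Real.pi) ^ ((d : ℝ) / 2))⁻¹ : ℝ) *
        Complex.exp (-(1 / 2) * ‖x‖ ^ 2 + Complex.I * (inner ℝ t x : ℝ)) := fun x => by
    rw [ENNReal.toReal_ofReal (by positivity), Complex.real_smul, Complex.ofReal_mul, mul_assoc,
      Complex.ofReal_exp, ← Complex.exp_add, real_inner_comm]
    congr 2
    push_cast
    ring
  simp only [e1]
  rw [integral_const_mul, key]
  have e2 : ((Real.pi : ℂ) / (1 / 2)) ^ ((Module.finrank ℝ (Param d) : ℂ) / 2) =
      (((2 * Real.pi) ^ ((d : ℝ) / 2) : ℝ) : ℂ) := by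
    rw [Complex.ofReal_cpow (by positivity)]
    congr 1
    · push_cast; ring
    · simp
  rw [e2, ← mul_assoc, ← Complex.ofReal_mul, inv_mul_cancel₀ hpos.ne', Complex.ofReal_one, one_mul]
  congr 1
  rw [Complex.I_sq]
  ring

section Multivariate

variable {d : ℕ} {S : Matrix (Fin d) (Fin d) ℝ}

local notation "cl" => Matrix.toEuclideanCLM (n := Fin d) (𝕜 := ℝ)

lemma inner_toEuclideanCLM_right {A : Matrix (Fin d) (Fin d) ℝ} (hA : A.IsHermitian)
    (x y : Param d) : inner ℝ x (cl A y) = inner ℝ (cl A x) y := by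
  have h : IsSelfAdjoint (cl A) := (show IsSelfAdjoint A from hA).map _
  rw [← ContinuousLinearMap.adjoint_inner_left, h.adjoint_eq]

lemma norm_sq_toEuclideanCLM_sqrt (hS : S.PosSemidef) (x : Param d) :
    ‖cl (CFC.sqrt S) x‖ ^ 2 = quadForm S x := by
  have hsa : (CFC.sqrt S).IsHermitian := (Matrix.nonneg_iff_posSemidef.1 (CFC.sqrt_nonneg S)).isHermitian
  rw [← real_inner_self_eq_norm_sq, ← inner_toEuclideanCLM_right hsa, quadForm,
    ← ContinuousLinearMap.comp_apply, ← ContinuousLinearMap.mul_def, ← map_mul,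
    CFC.sqrt_mul_sqrt_self _ hS.nonneg]

lemma quadForm_inv_toEuclideanCLM_sqrt (hS : S.PosDef) (x : Param d) :
    quadForm S⁻¹ (cl (CFC.sqrt S) x) = ‖x‖ ^ 2 := by
  have hsa : (CFC.sqrt S).IsHermitian := (Matrix.nonneg_iff_posSemidef.1 (CFC.sqrt_nonneg S)).isHermitian
  have hu : IsUnit (CFC.sqrt S).det := by
    rw [isUnit_iff_ne_zero, hS.posSemidef.det_sqrt]
    simpa [RCLike.sqrt_of_nonneg hS.det_pos.le] using (Real.sqrt_pos.2 hS.det_pos).ne'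
  have e : CFC.sqrt S * S⁻¹ * CFC.sqrt S = 1 := by
    rw [mul_assoc]
    conv_lhs => rw [← CFC.sqrt_mul_sqrt_self S hS.posSemidef.nonneg]
    rw [Matrix.mul_inv_rev]
    rw [CFC.sqrt_mul_sqrt_self S hS.posSemidef.nonneg, mul_assoc, Matrix.nonsing_inv_mul _ hu,
      mul_one, Matrix.mul_nonsing_inv _ hu]
  rw [quadForm, ← inner_toEuclideanCLM_right hsa, ← ContinuousLinearMap.comp_apply,
    ← ContinuousLinearMap.comp_apply, ← ContinuousLinearMap.mul_def,
    ← ContinuousLinearMap.mul_def, ← map_mul, ← map_mul, e, map_one,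
    one_apply_eq_self, real_inner_self_eq_norm_sq]

/-- The Lebesgue density of a nondegenerate centred Gaussian measure. -/
lemma multivariateGaussian_eq_withDensity (hS : S.PosDef) :
    multivariateGaussian 0 S = (volume : Measure (Param d)).withDensity fun x =>
      ENNReal.ofReal (√(S⁻¹.det) / (2 * Real.pi) ^ ((d : ℝ) / 2) *
        Real.exp (-(quadForm S⁻¹ x / 2))) := by
  set q : Param d → ℝ := fun x => ((2 * Real.pi) ^ ((d : ℝ) / 2))⁻¹ *
    Real.exp (-(quadForm S⁻¹ x / 2)) with hq
  have mq : Measurable q := by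
    have := measurable_quadForm S⁻¹
    fun_prop
  have hdet : LinearMap.det (cl (CFC.sqrt S) : Param d →ₗ[ℝ] Param d) = √S.det := by
    rw [Matrix.coe_toEuclideanCLM_eq_toEuclideanLin, Matrix.toEuclideanLin_eq_toLin_orthonormal,
      LinearMap.det_toLin, hS.posSemidef.det_sqrt, RCLike.sqrt_of_nonneg hS.det_pos.le]
    simp
  have hdpos : 0 < √S.det := Real.sqrt_pos.2 hS.det_pos
  have hmap := Measure.map_linearMap_addHaar_eq_smul_addHaar (volume : Measure (Param d))
    (f := (cl (CFC.sqrt S) : Param d →ₗ[ℝ] Param d)) (by rw [hdet]; exact hdpos.ne')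
  ext A hA
  rw [multivariateGaussian, Measure.map_apply (by fun_prop) hA, stdGaussian_eq_withDensity,
    withDensity_apply _ (hA.preimage (by fun_prop)), withDensity_apply _ hA]
  simp only [zero_add]
  have e1 : ∫⁻ x in (fun x => cl (CFC.sqrt S) x) ⁻¹' A,
      ENNReal.ofReal (((2 * Real.pi) ^ ((d : ℝ) / 2))⁻¹ * Real.exp (-(‖x‖ ^ 2 / 2))) =
      ∫⁻ x in (fun x => cl (CFC.sqrt S) x) ⁻¹' A, ENNReal.ofReal (q (cl (CFC.sqrt S) x)) := by
    simp only [hq, quadForm_inv_toEuclideanCLM_sqrt hS]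
  rw [e1, ← setLIntegral_map hA mq.ennreal_ofReal (by fun_prop)]
  rw [ContinuousLinearMap.coe_coe] at hmap
  rw [show (fun x => cl (CFC.sqrt S) x) = ⇑(cl (CFC.sqrt S)) from rfl, hmap,
    Measure.restrict_smul, lintegral_smul_measure, smul_eq_mul,
    ← lintegral_const_mul _ mq.ennreal_ofReal]
  refine lintegral_congr fun x => ?_
  rw [← ENNReal.ofReal_mul (abs_nonneg _), hdet, hq]
  congr 1
  have hdi : S⁻¹.det = (S.det)⁻¹ := by rw [Matrix.det_nonsing_inv, Ring.inverse_eq_inv']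
  rw [abs_of_pos (inv_pos.2 hdpos), hdi, Real.sqrt_inv]
  ring

lemma quadForm_eq_sum_eigenvalues (hS : S.IsHermitian) (x : Param d) :
    quadForm S x = ∑ i, hS.eigenvalues i * inner ℝ (hS.eigenvectorBasis i) x ^ 2 := by
  have h : ∀ i, cl S (hS.eigenvectorBasis i) = hS.eigenvalues i • hS.eigenvectorBasis i := by
    intro i
    ext j
    have := congrFun (hS.mulVec_eigenvectorBasis i) j
    simpa using this
  rw [quadForm, ← hS.eigenvectorBasis.sum_inner_mul_inner]
  refine Finset.sum_congr rfl fun i _ => ?_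
  rw [inner_toEuclideanCLM_right hS (hS.eigenvectorBasis i), h, real_inner_smul_left,
    real_inner_comm]
  ring

/-- In an eigenbasis of `S` the standard Gaussian still has independent standard coordinates, and
`‖S^{1/2} g‖² = ⟨g, S g⟩` is diagonal. Every estimate on the norm thus becomes one-dimensional. -/
lemma map_norm_sq_multivariateGaussian (hS : S.PosSemidef) :
    (multivariateGaussian 0 S).map (fun x => ‖x‖ ^ 2) =
      (Measure.pi fun _ : Fin d => gaussianReal 0 1).map
        fun x => ∑ i, hS.isHermitian.eigenvalues i * x i ^ 2 := by
  have hb := stdGaussian_eq_map_pi_orthonormalBasis hS.isHermitian.eigenvectorBasis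
  rw [multivariateGaussian, hb, Measure.map_map (by fun_prop) (by fun_prop),
    Measure.map_map (by fun_prop) (by fun_prop)]
  congr 1
  ext x
  simp only [Function.comp_apply, zero_add]
  rw [norm_sq_toEuclideanCLM_sqrt hS, quadForm_eq_sum_eigenvalues hS.isHermitian]
  refine Finset.sum_congr rfl fun i _ => ?_
  rw [inner_sum, Finset.sum_eq_single i]
  · simp [real_inner_smul_right]
  · intro j _ hj
    rw [real_inner_smul_right, hS.isHermitian.eigenvectorBasis.inner_eq_zero hj.symm, mul_zero]
  · simp

end Multivariate

/-! ### Fourth moment and concentration of the norm of a Gaussian vector -/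

lemma integral_pow_four_gaussianReal : ∫ x, x ^ 4 ∂(gaussianReal 0 1) = 3 := by
  rw [integral_gaussianReal_eq_integral_smul one_ne_zero]
  have h1 := integral_rpow_mul_exp_neg_mul_rpow (p := 2) (q := 4) (b := 1 / 2) (by norm_num)
    (by norm_num) (by norm_num)
  have h2 := integral_comp_abs (f := fun x : ℝ => x ^ 4 * Real.exp (-(x ^ 2 / 2)))
  have e1 : ∀ x : ℝ, gaussianPDFReal 0 1 x • x ^ 4 =
      (√(2 * Real.pi))⁻¹ * (|x| ^ 4 * Real.exp (-(|x| ^ 2 / 2))) := fun x => by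
    have : |x| ^ 4 = x ^ 4 := by rw [show (4 : ℕ) = 2 * 2 by norm_num, pow_mul, sq_abs, pow_mul]
    rw [gaussianPDFReal, this, sq_abs, smul_eq_mul, NNReal.coe_one, mul_one]
    ring_nf
  simp only [e1]
  rw [integral_const_mul, h2]
  have e2 : ∫ x in Set.Ioi (0 : ℝ), x ^ 4 * Real.exp (-(x ^ 2 / 2)) =
      ∫ x in Set.Ioi (0 : ℝ), x ^ (4 : ℝ) * Real.exp (-(1 / 2) * x ^ (2 : ℝ)) := by
    refine setIntegral_congr_fun measurableSet_Ioi fun x hx => ?_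
    norm_cast
    ring_nf
  rw [e2, h1]
  have g : Real.Gamma ((4 + 1) / 2) = 3 / 4 * √Real.pi := by
    rw [show ((4 : ℝ) + 1) / 2 = (1 / 2 + 1) + 1 by norm_num, Real.Gamma_add_one (by norm_num),
      Real.Gamma_add_one (by norm_num), Real.Gamma_one_half_eq]
    ring
  have p : ((1 : ℝ) / 2) ^ (-(4 + 1 : ℝ) / 2) = 4 * √2 := by
    rw [one_div, Real.inv_rpow (by norm_num), ← Real.rpow_neg (by norm_num),
      show -(-(4 + 1 : ℝ) / 2) = 2 + 1 / 2 by norm_num, Real.rpow_add (by norm_num),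
      ← Real.sqrt_eq_rpow]
    norm_num
  rw [g, p, Real.sqrt_mul (by norm_num)]
  have := Real.sqrt_pos.2 Real.pi_pos
  field_simp

/-- The integral equals `(1 - 2t)^{-1/2}`; write `(1 - 2t)⁻¹ = 1 + 2t / (1 - 2t)` and use `1 + u ≤
exp u`. An exponent linear in `t`, up to the denominator, lets the coordinates sum to a trace. -/
lemma integral_exp_mul_sq_gaussianReal_le {t : ℝ} (ht : 2 * t < 1) :
    Integrable (fun x => Real.exp (t * x ^ 2)) (gaussianReal 0 1) ∧
      ∫ x, Real.exp (t * x ^ 2) ∂(gaussianReal 0 1) ≤ Real.exp (t / (1 - 2 * t)) := by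
  have e1 : ∀ x : ℝ, gaussianPDFReal 0 1 x • Real.exp (t * x ^ 2) =
      (√(2 * Real.pi))⁻¹ * Real.exp (-(1 / 2 - t) * x ^ 2) := fun x => by
    rw [gaussianPDFReal, smul_eq_mul, mul_assoc, ← Real.exp_add, NNReal.coe_one, mul_one]
    ring_nf
  constructor
  · rw [gaussianReal_of_var_ne_zero _ one_ne_zero, integrable_withDensity_iff_integrable_smul'
      (measurable_gaussianPDF _ _) (by simp [gaussianPDF])]
    simp only [toReal_gaussianPDF, e1]
    exact (integrable_exp_neg_mul_sq (by linarith)).const_mul _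
  · rw [integral_gaussianReal_eq_integral_smul one_ne_zero]
    simp only [e1]
    rw [integral_const_mul, integral_gaussian, ← Real.sqrt_inv, ← Real.sqrt_mul (by positivity)]
    have h0 : 0 < 1 - 2 * t := by linarith
    have e2 : (2 * Real.pi)⁻¹ * (Real.pi / (1 / 2 - t)) = (1 - 2 * t)⁻¹ := by
      have := Real.pi_pos
      have : (1 / 2 - t) ≠ 0 := by linarith
      field_simp
    rw [e2, Real.sqrt_le_left (Real.exp_pos _).le, ← Real.exp_nat_mul]
    have e3 : (1 - 2 * t)⁻¹ = 2 * (t / (1 - 2 * t)) + 1 := by field_simp; ring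
    rw [e3]
    push_cast
    exact Real.add_one_le_exp _

section Multivariate

variable {d : ℕ} {S : Matrix (Fin d) (Fin d) ℝ}

lemma trace_eq_sum_eigenvalues (hS : S.IsHermitian) : S.trace = ∑ i, hS.eigenvalues i := by
  simpa using hS.trace_eq_sum_eigenvalues

lemma integrable_pow_four_pi (i : Fin d) :
    Integrable (fun x : Fin d → ℝ => x i ^ 4) (Measure.pi fun _ => gaussianReal 0 1) := by
  have h : Integrable (fun x : ℝ => x ^ 4) (gaussianReal 0 1) := by
    -- A non-integrable function has integral `0` by convention, whereas this one has integral `3`.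
    by_contra h
    have := integral_pow_four_gaussianReal
    rw [integral_undef h] at this
    norm_num at this
  exact (measurePreserving_eval (fun _ : Fin d => gaussianReal 0 1) i).integrable_comp_of_integrable
    h

/-- Cauchy–Schwarz with weights `l i` gives `(∑ l x²)² ≤ (∑ l)(∑ l x⁴)`, and each coordinate has
fourth moment `3`. -/
lemma integral_norm_pow_four_multivariateGaussian_le (hS : S.PosSemidef) :
    Integrable (fun x => ‖x‖ ^ 4) (multivariateGaussian 0 S) ∧
      ∫ x, ‖x‖ ^ 4 ∂(multivariateGaussian 0 S) ≤ 3 * S.trace ^ 2 := by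
  set l := hS.isHermitian.eigenvalues with hl
  have hl0 : ∀ i, 0 ≤ l i := hS.eigenvalues_nonneg
  set P : Measure (Fin d → ℝ) := Measure.pi fun _ => gaussianReal 0 1 with hP
  have hmap := map_norm_sq_multivariateGaussian hS
  rw [← hl] at hmap
  have hml : Measurable fun x : Fin d → ℝ => ∑ i, l i * x i ^ 2 :=
    Finset.measurable_sum _ fun i _ => by fun_prop
  have hbound : ∀ x : Fin d → ℝ, (∑ i, l i * x i ^ 2) ^ 2 ≤
      S.trace * ∑ i, l i * x i ^ 4 := fun x => by
    rw [trace_eq_sum_eigenvalues hS.isHermitian]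
    refine Finset.sum_sq_le_sum_mul_sum_of_sq_le_mul _ (fun i _ => hl0 i)
      (fun i _ => mul_nonneg (hl0 i) (by positivity)) fun i _ => le_of_eq (by ring)
  have hint : Integrable (fun x : Fin d → ℝ => S.trace * ∑ i, l i * x i ^ 4) P :=
    (integrable_finsetSum _ fun i _ => (integrable_pow_four_pi i).const_mul _).const_mul _
  have hint2 : Integrable (fun x : Fin d → ℝ => (∑ i, l i * x i ^ 2) ^ 2) P := by
    refine hint.mono' (hml.pow_const 2).aestronglyMeasurable (Eventually.of_forall fun x => ?_)
    rw [Real.norm_of_nonneg (sq_nonneg _)]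
    exact hbound x
  have e4 : (fun x : Param d => ‖x‖ ^ 4) = (fun t : ℝ => t ^ 2) ∘ fun x => ‖x‖ ^ 2 := by
    ext x; simp only [Function.comp_apply]; ring
  have h2 : Integrable (fun t : ℝ => t ^ 2) ((multivariateGaussian 0 S).map fun x => ‖x‖ ^ 2) := by
    rw [hmap, integrable_map_measure (by fun_prop) hml.aemeasurable]
    exact hint2
  constructor
  · rw [e4, ← integrable_map_measure (by fun_prop) (by fun_prop)]
    exact h2
  · have : ∫ x, ‖x‖ ^ 4 ∂(multivariateGaussian 0 S) =
        ∫ x : Fin d → ℝ, (∑ i, l i * x i ^ 2) ^ 2 ∂P := by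
      rw [← integral_map (φ := fun x : Fin d → ℝ => ∑ i, l i * x i ^ 2) (f := fun t : ℝ => t ^ 2)
        hml.aemeasurable (by fun_prop), ← hmap, integral_map (by fun_prop) (by fun_prop)]
      simp only [← pow_mul]
    rw [this]
    refine (integral_mono hint2 hint hbound).trans (le_of_eq ?_)
    rw [integral_const_mul, integral_finsetSum _ fun i _ => (integrable_pow_four_pi i).const_mul _]
    have : ∀ i : Fin d, ∫ x : Fin d → ℝ, l i * x i ^ 4 ∂P = l i * 3 := fun i => by
      rw [integral_const_mul, ← integral_pow_four_gaussianReal]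
      congr 1
      rw [← (measurePreserving_eval (fun _ : Fin d => gaussianReal 0 1) i).map_eq,
        integral_map (measurable_pi_apply i).aemeasurable (by fun_prop)]
    rw [Finset.sum_congr rfl fun i _ => this i, ← Finset.sum_mul, hl, ← trace_eq_sum_eigenvalues hS.isHermitian]
    ring

/-- Gaussian concentration of the norm. -/
theorem multivariateGaussian_norm_gt_le (hS : S.PosSemidef) {σ : ℝ} (hσ : 0 < σ)
    (hSσ : ∀ i, hS.isHermitian.eigenvalues i ≤ σ) (htr : 0 < S.trace) {R : ℝ}
    (hR : √S.trace < R) :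
    (multivariateGaussian 0 S).real {x | R < ‖x‖} ≤
      Real.exp (-(1 / 2) * (R - √S.trace) ^ 2 * σ⁻¹) := by
  set l := hS.isHermitian.eigenvalues with hl
  have hl0 : ∀ i, 0 ≤ l i := hS.eigenvalues_nonneg
  set P : Measure (Fin d → ℝ) := Measure.pi fun _ => gaussianReal 0 1 with hP
  set τ := √S.trace with hτ
  have hτ0 : 0 < τ := Real.sqrt_pos.2 htr
  have hτ2 : ∑ i, l i = τ ^ 2 := by
    rw [hτ, Real.sq_sqrt htr.le, trace_eq_sum_eigenvalues hS.isHermitian]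
  have hR0 : 0 < R := hτ0.trans hR
  -- The Chernoff parameter with `1 - 2sσ = τ / R`. The exponent `sτ² / (τ / R) - sR²` is then
  -- `-sR(R - τ) = -(R - τ)² / (2σ)`.
  set s := (1 - τ / R) / (2 * σ) with hs
  have hq : τ / R < 1 := (div_lt_one hR0).2 hR
  have hs0 : 0 ≤ s := div_nonneg (by linarith) (by positivity)
  have hsσ : 1 - 2 * (s * σ) = τ / R := by rw [hs]; field_simp; ring
  have hsl : ∀ i, 1 - 2 * (s * l i) ≥ τ / R := fun i => by
    have := mul_le_mul_of_nonneg_left (hSσ i) hs0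
    linarith
  have hqpos : 0 < τ / R := by positivity
  have h1 : ∀ i, Integrable (fun x => Real.exp (s * l i * x ^ 2)) (gaussianReal 0 1) ∧
      ∫ x, Real.exp (s * l i * x ^ 2) ∂(gaussianReal 0 1) ≤ Real.exp (s * l i / (τ / R)) := by
    intro i
    obtain ⟨a, b⟩ := integral_exp_mul_sq_gaussianReal_le (t := s * l i)
      (by linarith [hsl i])
    refine ⟨a, b.trans (Real.exp_le_exp.2 ?_)⟩
    exact div_le_div_of_nonneg_left (mul_nonneg hs0 (hl0 i)) hqpos (hsl i)
  have eprod : ∀ x : Fin d → ℝ, Real.exp (s * ∑ i, l i * x i ^ 2) =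
      ∏ i, Real.exp (s * l i * x i ^ 2) := fun x => by
    rw [← Real.exp_sum, Finset.mul_sum]
    simp only [mul_assoc]
  have hint : Integrable (fun x : Fin d → ℝ => Real.exp (s * ∑ i, l i * x i ^ 2)) P := by
    simp only [eprod]
    exact Integrable.fintype_prod (f := fun i x => Real.exp (s * l i * x ^ 2)) fun i => (h1 i).1
  have hmgf : mgf (fun x : Fin d → ℝ => ∑ i, l i * x i ^ 2) P s ≤
      Real.exp (s * τ ^ 2 / (τ / R)) := by
    rw [mgf]
    simp only [eprod]
    rw [hP, integral_fintype_prod_eq_prod (f := fun i x => Real.exp (s * l i * x ^ 2))]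
    refine (Finset.prod_le_prod (fun i _ => integral_nonneg fun x => (Real.exp_pos _).le)
      fun i _ => (h1 i).2).trans (le_of_eq ?_)
    rw [← Real.exp_sum, ← Finset.sum_div, ← Finset.mul_sum, hτ2]
  have hset : (multivariateGaussian 0 S).real {x | R < ‖x‖} ≤
      P.real {x | R ^ 2 ≤ ∑ i, l i * x i ^ 2} := by
    have e := congrArg (fun ν : Measure ℝ => ν.real (Set.Ici (R ^ 2)))
      (map_norm_sq_multivariateGaussian hS)
    rw [map_measureReal_apply (by fun_prop) measurableSet_Ici, map_measureReal_apply
      (Finset.measurable_sum _ fun i _ => by fun_prop) measurableSet_Ici] at e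
    refine (measureReal_mono ?_).trans (le_of_eq e)
    intro x hx
    exact pow_le_pow_left₀ hR0.le (le_of_lt hx) 2
  refine hset.trans ((measure_ge_le_exp_mul_mgf (R ^ 2) hs0 hint).trans ?_)
  refine (mul_le_mul_of_nonneg_left hmgf (Real.exp_pos _).le).trans (le_of_eq ?_)
  rw [← Real.exp_add]
  congr 1
  rw [hs]
  field_simp
  ring

end Multivariate

/-! ### Taylor estimates -/

section Taylor

variable {d : ℕ} {f : Param d → ℝ} {x x₀ : Param d}

lemma ThriceDifferentiableAt.differentiableAt (h : ThriceDifferentiableAt f x) :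
    DifferentiableAt ℝ f x := h.1.self_of_nhds

lemma ThriceDifferentiableAt.differentiableAt_fderiv (h : ThriceDifferentiableAt f x) :
    DifferentiableAt ℝ (fderiv ℝ f) x := h.2.1.self_of_nhds

lemma ThriceDifferentiableAt.fderiv_fderiv_comm (h : ThriceDifferentiableAt f x) (u v : Param d) :
    fderiv ℝ (fderiv ℝ f) x u v = fderiv ℝ (fderiv ℝ f) x v u :=
  second_derivative_symmetric_of_eventually
    (h.1.mono fun _ hy => hy.hasFDerivAt) h.differentiableAt_fderiv.hasFDerivAt u v

lemma abs_fderiv_fderiv_fderiv_le (f : Param d → ℝ) (x u v w : Param d) :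
    |fderiv ℝ (fderiv ℝ (fderiv ℝ f)) x u v w| ≤
      thirdDerivNorm f x * ‖u‖ * ‖v‖ * ‖w‖ := by
  set T := fderiv ℝ (fderiv ℝ (fderiv ℝ f)) x with hT
  have hb : BddAbove {r : ℝ | ∃ u v w : Param d, ‖u‖ ≤ 1 ∧ ‖v‖ ≤ 1 ∧ ‖w‖ ≤ 1 ∧
      r = |T u v w|} := by
    refine ⟨‖T‖, ?_⟩
    rintro _ ⟨u, v, w, hu, hv, hw, rfl⟩
    calc |T u v w| ≤ ‖T u v‖ * ‖w‖ := (T u v).le_opNorm w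
      _ ≤ (‖T‖ * ‖u‖ * ‖v‖) * ‖w‖ := by gcongr; exact T.le_opNorm₂ u v
      _ ≤ (‖T‖ * 1 * 1) * 1 := by gcongr
      _ = ‖T‖ := by ring
  rcases eq_or_ne u 0 with rfl | hu
  · simp
  rcases eq_or_ne v 0 with rfl | hv
  · simp
  rcases eq_or_ne w 0 with rfl | hw
  · simp
  have key : |T (‖u‖⁻¹ • u) (‖v‖⁻¹ • v) (‖w‖⁻¹ • w)| ≤ thirdDerivNorm f x := by
    refine le_csSup hb ⟨_, _, _, ?_, ?_, ?_, rfl⟩ <;>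
    · rw [norm_smul, norm_inv, norm_norm, inv_mul_cancel₀ (norm_ne_zero_iff.2 (by assumption))]
  have hu' := norm_pos_iff.2 hu
  have hv' := norm_pos_iff.2 hv
  have hw' := norm_pos_iff.2 hw
  simp only [map_smul, _root_.smul_apply, smul_eq_mul, abs_mul, abs_inv,
    abs_norm] at key
  calc |T u v w| = ‖w‖⁻¹ * (‖v‖⁻¹ * (‖u‖⁻¹ * |T u v w|)) * ‖u‖ * ‖v‖ * ‖w‖ := by field_simp
    _ ≤ thirdDerivNorm f x * ‖u‖ * ‖v‖ * ‖w‖ := by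
      gcongr

lemma norm_fderiv_fderiv_fderiv_le {N : ℝ} (hN : 0 ≤ N) (h : thirdDerivNorm f x ≤ N) :
    ‖fderiv ℝ (fderiv ℝ (fderiv ℝ f)) x‖ ≤ N := by
  refine ContinuousLinearMap.opNorm_le_bound _ hN fun u => ?_
  refine ContinuousLinearMap.opNorm_le_bound _ (by positivity) fun v => ?_
  refine ContinuousLinearMap.opNorm_le_bound _ (by positivity) fun w => ?_
  refine (abs_fderiv_fderiv_fderiv_le f x u v w).trans ?_
  gcongr

variable {N r : ℝ}

lemma add_smul_mem_closedBall {h : Param d} (hh : ‖h‖ ≤ r) {t : ℝ} (ht : t ∈ Set.Icc (0 : ℝ) 1) :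
    ‖x₀ + t • h - x₀‖ ≤ r := by
  rw [add_sub_cancel_left, norm_smul, Real.norm_of_nonneg ht.1]
  exact (mul_le_of_le_one_left (norm_nonneg _) ht.2).trans hh

lemma hasDerivAt_comp_add_smul {F : Type*} [NormedAddCommGroup F] [NormedSpace ℝ F]
    {g : Param d → F} {h : Param d} {t : ℝ} (hg : DifferentiableAt ℝ g (x₀ + t • h)) :
    HasDerivAt (fun s : ℝ => g (x₀ + s • h)) (fderiv ℝ g (x₀ + t • h) h) t := by
  have h1 : HasDerivAt (fun s : ℝ => x₀ + s • h) h t := by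
    simpa using ((hasDerivAt_id t).smul_const h).const_add x₀
  exact hg.hasFDerivAt.comp_hasDerivAt t h1

/-- A comparison principle on the unit interval. -/
lemma norm_le_of_norm_deriv_le {F : Type*} [NormedAddCommGroup F] [NormedSpace ℝ F] {g g' : ℝ → F}
    (hg : ∀ t ∈ Set.Icc (0 : ℝ) 1, HasDerivAt g (g' t) t) (h0 : g 0 = 0) {c : ℝ} {k : ℕ}
    (hb : ∀ t ∈ Set.Icc (0 : ℝ) 1, ‖g' t‖ ≤ c * t ^ k) : ‖g 1‖ ≤ c / (k + 1) := by
  have := image_norm_le_of_norm_deriv_right_le_deriv_boundary (a := 0) (b := 1) (f := g) (f' := g')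
    (B := fun t => c / (k + 1) * t ^ (k + 1)) (B' := fun t => c * t ^ k)
    (fun t ht => (hg t ht).continuousAt.continuousWithinAt)
    (fun t ht => (hg t ⟨ht.1, ht.2.le⟩).hasDerivWithinAt) (by simp [h0])
    (fun t => by
      have h1 := (hasDerivAt_pow (k + 1) t).const_mul (c / (k + 1))
      refine h1.congr_deriv ?_
      push_cast
      field_simp)
    (fun t ht => hb t ⟨ht.1, ht.2.le⟩) (x := 1) (by simp)
  simpa using this

lemma norm_fderiv_fderiv_sub_le (hN : 0 ≤ N)
    (hd : ∀ x, ‖x - x₀‖ ≤ r → ThriceDifferentiableAt f x)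
    (hb : ∀ x, ‖x - x₀‖ ≤ r → thirdDerivNorm f x ≤ N) (hx : ‖x - x₀‖ ≤ r) :
    ‖fderiv ℝ (fderiv ℝ f) x - fderiv ℝ (fderiv ℝ f) x₀‖ ≤ N * ‖x - x₀‖ := by
  have hr : 0 ≤ r := (norm_nonneg _).trans hx
  refine (convex_closedBall x₀ r).norm_image_sub_le_of_norm_fderiv_le (𝕜 := ℝ)
    (fun y hy => (hd y ?_).2.2) (fun y hy => norm_fderiv_fderiv_fderiv_le hN (hb y ?_)) ?_ ?_
  · rwa [← mem_closedBall_iff_norm]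
  · rwa [← mem_closedBall_iff_norm]
  · simpa using hr
  · rwa [mem_closedBall_iff_norm]

lemma norm_fderiv_sub_taylor_le (hN : 0 ≤ N)
    (hd : ∀ x, ‖x - x₀‖ ≤ r → ThriceDifferentiableAt f x)
    (hb : ∀ x, ‖x - x₀‖ ≤ r → thirdDerivNorm f x ≤ N) {h : Param d} (hh : ‖h‖ ≤ r) :
    ‖fderiv ℝ f (x₀ + h) - fderiv ℝ f x₀ - fderiv ℝ (fderiv ℝ f) x₀ h‖ ≤ N * ‖h‖ ^ 2 / 2 := by
  have key := norm_le_of_norm_deriv_le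
    (g := fun t : ℝ => fderiv ℝ f (x₀ + t • h) - fderiv ℝ f x₀ -
      t • fderiv ℝ (fderiv ℝ f) x₀ h)
    (g' := fun t => fderiv ℝ (fderiv ℝ f) (x₀ + t • h) h - (1 : ℝ) • fderiv ℝ (fderiv ℝ f) x₀ h)
    (c := N * ‖h‖ ^ 2) (k := 1) (fun t ht => by
      refine HasDerivAt.sub (HasDerivAt.sub_const _ (hasDerivAt_comp_add_smul
        (hd _ (add_smul_mem_closedBall hh ht)).differentiableAt_fderiv)) ?_
      exact (hasDerivAt_id t).smul_const _) (by simp) (fun t ht => by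
      have h1 := norm_fderiv_fderiv_sub_le hN hd hb (add_smul_mem_closedBall (x₀ := x₀) hh ht)
      rw [one_smul, ← _root_.sub_apply]
      refine (ContinuousLinearMap.le_opNorm _ _).trans ?_
      rw [add_sub_cancel_left, norm_smul, Real.norm_of_nonneg ht.1] at h1
      calc _ ≤ N * (t * ‖h‖) * ‖h‖ := by gcongr
        _ = _ := by ring)
  simp only [one_smul] at key
  norm_num at key
  exact key

lemma abs_sub_taylor_le (hN : 0 ≤ N)
    (hd : ∀ x, ‖x - x₀‖ ≤ r → ThriceDifferentiableAt f x)
    (hb : ∀ x, ‖x - x₀‖ ≤ r → thirdDerivNorm f x ≤ N) {h : Param d} (hh : ‖h‖ ≤ r) :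
    |f (x₀ + h) - f x₀ - fderiv ℝ f x₀ h - fderiv ℝ (fderiv ℝ f) x₀ h h / 2| ≤
      N * ‖h‖ ^ 3 / 6 := by
  have key := norm_le_of_norm_deriv_le
    (g := fun t : ℝ => f (x₀ + t • h) - f x₀ - t * fderiv ℝ f x₀ h -
      t ^ 2 * (fderiv ℝ (fderiv ℝ f) x₀ h h / 2))
    (g' := fun t => fderiv ℝ f (x₀ + t • h) h - 1 * fderiv ℝ f x₀ h -
      (2 * t) * (fderiv ℝ (fderiv ℝ f) x₀ h h / 2))
    (c := N * ‖h‖ ^ 3 / 2) (k := 2) (fun t ht => by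
      refine ((HasDerivAt.sub_const _ (hasDerivAt_comp_add_smul
        (hd _ (add_smul_mem_closedBall hh ht)).differentiableAt)).sub
          ((hasDerivAt_id t).mul_const _)).sub ?_
      simpa using (hasDerivAt_pow 2 t).mul_const (fderiv ℝ (fderiv ℝ f) x₀ h h / 2))
    (by simp) (fun t ht => by
      have hth : ‖t • h‖ ≤ r := by
        simpa using add_smul_mem_closedBall (x₀ := x₀) hh ht
      have h1 := norm_fderiv_sub_taylor_le hN hd hb hth
      have e : fderiv ℝ f (x₀ + t • h) h - 1 * fderiv ℝ f x₀ h -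
          (2 * t) * (fderiv ℝ (fderiv ℝ f) x₀ h h / 2) =
          (fderiv ℝ f (x₀ + t • h) - fderiv ℝ f x₀ - fderiv ℝ (fderiv ℝ f) x₀ (t • h)) h := by
        simp only [map_smul, _root_.sub_apply, _root_.smul_apply,
          smul_eq_mul]
        ring
      rw [e]
      refine (ContinuousLinearMap.le_opNorm _ _).trans ?_
      rw [norm_smul, Real.norm_of_nonneg ht.1] at h1
      calc _ ≤ N * (t * ‖h‖) ^ 2 / 2 * ‖h‖ := by gcongr
        _ = _ := by ring)
  simp only [one_smul, one_mul, one_pow] at key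
  rw [Real.norm_eq_abs] at key
  convert key using 1
  norm_num
  ring

/-- Second-order expansion with an upper bound of the Hessian on a convex set. -/
lemma le_add_fderiv_add_of_hessian_le {K : Set (Param d)} (hK : Convex ℝ K)
    (hd : ∀ x ∈ K, ThriceDifferentiableAt f x) {c : ℝ}
    (hc : ∀ x ∈ K, ∀ h, fderiv ℝ (fderiv ℝ f) x h h ≤ c * ‖h‖ ^ 2) {x y : Param d} (hx : x ∈ K)
    (hy : y ∈ K) : f y ≤ f x + fderiv ℝ f x (y - x) + c / 2 * ‖y - x‖ ^ 2 := by
  set h := y - x with hh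
  have hmem : ∀ t ∈ Set.Icc (0 : ℝ) 1, x + t • h ∈ K := fun t ht =>
    hK.add_smul_sub_mem hx hy ht
  have d1 : ∀ t ∈ Set.Icc (0 : ℝ) 1, HasDerivAt (fun t : ℝ => fderiv ℝ f x h + c * ‖h‖ ^ 2 * t -
      fderiv ℝ f (x + t • h) h) (c * ‖h‖ ^ 2 - fderiv ℝ (fderiv ℝ f) (x + t • h) h h) t := by
    intro t ht
    have e1 := hasDerivAt_comp_add_smul (hd _ (hmem t ht)).differentiableAt_fderiv
    have e2 : HasDerivAt (fun s : ℝ => fderiv ℝ f (x + s • h) h)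
        (fderiv ℝ (fderiv ℝ f) (x + t • h) h h) t := by
      simpa using e1.clm_apply (hasDerivAt_const t h)
    have e3 : HasDerivAt (fun t : ℝ => fderiv ℝ f x h + c * ‖h‖ ^ 2 * t) (c * ‖h‖ ^ 2) t := by
      simpa using ((hasDerivAt_id t).const_mul (c * ‖h‖ ^ 2)).const_add (fderiv ℝ f x h)
    exact e3.sub e2
  have m1 : MonotoneOn (fun t : ℝ => fderiv ℝ f x h + c * ‖h‖ ^ 2 * t -
      fderiv ℝ f (x + t • h) h) (Set.Icc 0 1) := by
    refine monotoneOn_of_hasDerivWithinAt_nonneg (convex_Icc 0 1)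
      (fun t ht => (d1 t ht).continuousAt.continuousWithinAt)
      (fun t ht => (d1 t (interior_subset ht)).hasDerivWithinAt) fun t ht => ?_
    have := hc _ (hmem t (interior_subset ht)) h
    linarith
  have d2 : ∀ t ∈ Set.Icc (0 : ℝ) 1, HasDerivAt (fun t : ℝ => fderiv ℝ f x h * t +
      c * ‖h‖ ^ 2 / 2 * t ^ 2 - f (x + t • h))
      (fderiv ℝ f x h + c * ‖h‖ ^ 2 * t - fderiv ℝ f (x + t • h) h) t := by
    intro t ht
    have e1 := hasDerivAt_comp_add_smul (hd _ (hmem t ht)).differentiableAt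
    have e2 := ((hasDerivAt_id t).const_mul (fderiv ℝ f x h)).add
      ((hasDerivAt_pow 2 t).const_mul (c * ‖h‖ ^ 2 / 2))
    refine (e2.sub e1).congr_deriv ?_
    push_cast
    ring
  have m2 : MonotoneOn (fun t : ℝ => fderiv ℝ f x h * t +
      c * ‖h‖ ^ 2 / 2 * t ^ 2 - f (x + t • h)) (Set.Icc 0 1) := by
    refine monotoneOn_of_hasDerivWithinAt_nonneg (convex_Icc 0 1)
      (fun t ht => (d2 t ht).continuousAt.continuousWithinAt)
      (fun t ht => (d2 t (interior_subset ht)).hasDerivWithinAt) fun t ht => ?_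
    have ht' := interior_subset ht
    have := m1 (Set.left_mem_Icc.2 zero_le_one) ht' ht'.1
    simpa using this
  have := m2 (Set.left_mem_Icc.2 zero_le_one) (Set.right_mem_Icc.2 zero_le_one) zero_le_one
  simp only [mul_zero, zero_smul, add_zero, one_smul, mul_one, one_pow, ne_eq,
    OfNat.ofNat_ne_zero, not_false_eq_true, zero_pow, zero_sub] at this
  rw [hh, add_sub_cancel] at this
  rw [hh]
  linarith

/-- The second-order necessary condition at a maximum. -/
lemma fderiv_fderiv_nonpos_of_isMax (hr : 0 < r) (hN : 0 ≤ N)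
    (hd : ∀ x, ‖x - x₀‖ ≤ r → ThriceDifferentiableAt f x)
    (hb : ∀ x, ‖x - x₀‖ ≤ r → thirdDerivNorm f x ≤ N) (hmax : ∀ x, f x ≤ f x₀)
    (h : Param d) : fderiv ℝ (fderiv ℝ f) x₀ h h ≤ 0 := by
  have h0 : fderiv ℝ f x₀ = 0 :=
    IsLocalMax.fderiv_eq_zero (Eventually.of_forall hmax)
  -- At a maximum the quadratic term along `t • h` cannot exceed the cubic remainder; dividing by
  -- `t²` leaves a bound of order `t`.
  have key : ∀ᶠ t in 𝓝[>] (0 : ℝ), fderiv ℝ (fderiv ℝ f) x₀ h h ≤ N * t * ‖h‖ ^ 3 / 3 := by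
    have c1 : ∀ᶠ t in 𝓝[>] (0 : ℝ), t * ‖h‖ < r := by
      apply eventually_nhdsWithin_of_eventually_nhds
      have : ContinuousAt (fun t : ℝ => t * ‖h‖) 0 := by fun_prop
      exact this.eventually (gt_mem_nhds (by simpa using hr))
    filter_upwards [c1, self_mem_nhdsWithin] with t ht ht0
    rw [Set.mem_Ioi] at ht0
    have hth : ‖t • h‖ = t * ‖h‖ := by rw [norm_smul, Real.norm_of_nonneg ht0.le]
    have h1 := (abs_le.1 (abs_sub_taylor_le hN hd hb (h := t • h) (by rw [hth]; exact ht.le))).1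
    rw [h0, hth] at h1
    simp only [map_smul, _root_.smul_apply, smul_eq_mul,
      _root_.zero_apply] at h1
    have h2 := hmax (x₀ + t • h)
    have h3 : t ^ 2 * fderiv ℝ (fderiv ℝ f) x₀ h h ≤ t ^ 2 * (N * t * ‖h‖ ^ 3 / 3) := by
      nlinarith
    exact le_of_mul_le_mul_left h3 (by positivity)
  have l : Tendsto (fun t : ℝ => N * t * ‖h‖ ^ 3 / 3) (𝓝[>] 0) (𝓝 0) := by
    have : ContinuousAt (fun t : ℝ => N * t * ‖h‖ ^ 3 / 3) 0 := by fun_prop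
    simpa using this.tendsto.mono_left (nhdsWithin_le_nhds (s := Set.Ioi 0))
  exact ge_of_tendsto l key

end Taylor

/-! ### Hessian matrices and eigenvalues -/

section Hessian

variable {d : ℕ}

lemma isHermitian_hessian {f : Param d → ℝ} {x : Param d} (h : ThriceDifferentiableAt f x) :
    (hessian f x).IsHermitian := by
  ext i j
  simp only [hessian, Matrix.conjTranspose_apply, Matrix.of_apply, star_trivial]
  exact h.fderiv_fderiv_comm _ _

lemma quadForm_hessian (f : Param d → ℝ) (x v : Param d) :
    quadForm (hessian f x) v = fderiv ℝ (fderiv ℝ f) x v v := by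
  have hv : v = ∑ i, v i • EuclideanSpace.single i (1 : ℝ) := by
    simpa using ((EuclideanSpace.basisFun (Fin d) ℝ).sum_repr v).symm
  rw [quadForm, Matrix.inner_toEuclideanCLM]
  conv_rhs => rw [hv]
  simp only [map_sum, map_smul, _root_.sum_apply, _root_.smul_apply,
    smul_eq_mul, dotProduct, Matrix.mulVec, hessian, Matrix.of_apply, Finset.mul_sum]
  rw [Finset.sum_comm]
  refine Finset.sum_congr rfl fun i _ => Finset.sum_congr rfl fun j _ => ?_
  ring

lemma quadForm_neg_smul (c : ℝ) (A : Matrix (Fin d) (Fin d) ℝ) (v : Param d) :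
    quadForm (-(c • A)) v = -(c * quadForm A v) := by
  simp [quadForm, real_inner_smul_right]

lemma quadForm_add_smul_one (c : ℝ) (A : Matrix (Fin d) (Fin d) ℝ) (v : Param d) :
    quadForm (A + c • 1) v = quadForm A v + c * ‖v‖ ^ 2 := by
  simp [quadForm, real_inner_smul_right, inner_add_right]

lemma quadForm_smul_vec (c : ℝ) (A : Matrix (Fin d) (Fin d) ℝ) (v : Param d) :
    quadForm A (c • v) = c ^ 2 * quadForm A v := by
  simp [quadForm, real_inner_smul_right, real_inner_smul_left]
  ring

lemma posDef_of_quadForm_pos {A : Matrix (Fin d) (Fin d) ℝ} (hA : A.IsHermitian)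
    (h : ∀ v, v ≠ 0 → 0 < quadForm A v) : A.PosDef := by
  refine hA.posDef_iff_eigenvalues_pos.2 fun i => ?_
  have hn : hA.eigenvectorBasis i ≠ 0 := hA.eigenvectorBasis.orthonormal.ne_zero i
  have := h _ hn
  rw [quadForm_eq_sum_eigenvalues hA, Finset.sum_eq_single i] at this
  · simpa using this
  · intro j _ hj
    rw [hA.eigenvectorBasis.inner_eq_zero hj]; simp
  · simp

lemma mulVec_eigenvectorBasis_ne_zero {A : Matrix (Fin d) (Fin d) ℝ} (hA : A.IsHermitian)
    (i : Fin d) : (hA.eigenvectorBasis i).ofLp ≠ 0 := by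
  intro h
  exact hA.eigenvectorBasis.orthonormal.ne_zero i (by ext j; exact congrFun h j)

lemma minEigenvalue_le {A : Matrix (Fin d) (Fin d) ℝ} {m : ℝ} {v : Fin d → ℝ} (hv : v ≠ 0)
    (h : A.mulVec v = m • v) : minEigenvalue A ≤ m := by
  refine csInf_le ?_ ?_
  -- Finiteness of the spectrum rules out the default value of the real infimum of a set unbounded
  -- below.
  · exact (Module.End.finite_hasEigenvalue (Matrix.toLin' A)).bddBelow
  · exact Module.End.hasEigenvalue_of_hasEigenvector
      (x := v) (Module.End.hasEigenvector_iff.2 ⟨Module.End.mem_eigenspace_iff.2 (by simpa using h), hv⟩)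

lemma minEigenvalue_mul_norm_sq_le {A : Matrix (Fin d) (Fin d) ℝ} (hA : A.IsHermitian)
    (v : Param d) : minEigenvalue A * ‖v‖ ^ 2 ≤ quadForm A v := by
  rw [quadForm_eq_sum_eigenvalues hA, ← hA.eigenvectorBasis.sum_sq_inner_right v, Finset.mul_sum]
  refine Finset.sum_le_sum fun i _ => mul_le_mul_of_nonneg_right ?_ (sq_nonneg _)
  exact minEigenvalue_le (mulVec_eigenvectorBasis_ne_zero hA i) (hA.mulVec_eigenvectorBasis i)

lemma posDef_of_minEigenvalue_pos {A : Matrix (Fin d) (Fin d) ℝ} (hA : A.IsHermitian)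
    (h : 0 < minEigenvalue A) : A.PosDef :=
  posDef_of_quadForm_pos hA fun v hv =>
    (mul_pos h (by have := norm_pos_iff.2 hv; positivity)).trans_le
      (minEigenvalue_mul_norm_sq_le hA v)

/-- An eigenvector of `A⁻¹` is an eigenvector of `A` for the reciprocal eigenvalue. -/
lemma eigenvalues_inv_le {A : Matrix (Fin d) (Fin d) ℝ} (hA : A.PosDef)
    (h : 0 < minEigenvalue A) (hB : A⁻¹.IsHermitian) (i : Fin d) :
    hB.eigenvalues i ≤ (minEigenvalue A)⁻¹ := by
  have hpos : 0 < hB.eigenvalues i := hA.inv.eigenvalues_pos i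
  rw [le_inv_comm₀ hpos h]
  refine minEigenvalue_le (mulVec_eigenvectorBasis_ne_zero hB i) ?_
  have h1 := congrArg (A.mulVec) (hB.mulVec_eigenvectorBasis i)
  rw [Matrix.mulVec_mulVec, Matrix.mul_nonsing_inv _ (isUnit_iff_ne_zero.2 hA.det_pos.ne'),
    Matrix.one_mulVec, Matrix.mulVec_smul] at h1
  conv_rhs => rw [h1]
  rw [smul_smul, inv_mul_cancel₀ hpos.ne', one_smul]

lemma eigenvalues_le_opNorm {A : Matrix (Fin d) (Fin d) ℝ} (hA : A.IsHermitian) (i : Fin d) :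
    hA.eigenvalues i ≤ opNorm A := by
  have h : Matrix.toEuclideanCLM (n := Fin d) (𝕜 := ℝ) A (hA.eigenvectorBasis i) =
      hA.eigenvalues i • hA.eigenvectorBasis i := by
    ext j
    simpa using congrFun (hA.mulVec_eigenvectorBasis i) j
  have h1 := (Matrix.toEuclideanCLM (n := Fin d) (𝕜 := ℝ) A).le_opNorm (hA.eigenvectorBasis i)
  rw [h, norm_smul, hA.eigenvectorBasis.norm_eq_one, mul_one, mul_one] at h1
  exact (le_abs_self _).trans h1

end Hessian

/-! ### Rescaled densities -/

section Rescaled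

variable {d : ℕ}

lemma map_smul_sub_volume {s : ℝ} (hs : 0 < s) (c : Param d) :
    (volume : Measure (Param d)).map (fun θ => s • (θ - c)) =
      ENNReal.ofReal ((s ^ d)⁻¹) • volume := by
  have h : (fun θ : Param d => s • (θ - c)) = (fun t => s • t) ∘ fun θ => θ - c := rfl
  rw [h, ← Measure.map_map (by fun_prop) (by fun_prop),
    (measurePreserving_sub_right volume c).map_eq, Measure.map_addHaar_smul _ hs.ne']
  simp [abs_of_pos hs]

/-- The densities need to agree only over `A`, and `p` need not be measurable. The posterior density
can therefore be replaced by a function controlled only near the MAP. -/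
lemma map_withDensity_smul_sub_real {p q : Param d → ℝ} (hq : Measurable q) (hq0 : ∀ t, 0 ≤ q t)
    {s : ℝ} (hs : 0 < s) (c : Param d) {A : Set (Param d)} (hA : MeasurableSet A)
    (hpq : ∀ θ, s • (θ - c) ∈ A → p θ = q (s • (θ - c))) :
    (((volume : Measure (Param d)).withDensity fun θ => ENNReal.ofReal (p θ)).map
      fun θ => s • (θ - c)).real A = (s ^ d)⁻¹ * ∫ t in A, q t := by
  have hm : Measurable fun θ : Param d => s • (θ - c) := by fun_prop
  rw [measureReal_def, Measure.map_apply hm hA, withDensity_apply _ (hA.preimage hm)]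
  have e1 : ∫⁻ θ in (fun θ => s • (θ - c)) ⁻¹' A, ENNReal.ofReal (p θ) =
      ∫⁻ θ in (fun θ => s • (θ - c)) ⁻¹' A, ENNReal.ofReal (q (s • (θ - c))) :=
    setLIntegral_congr_fun (hA.preimage hm) fun θ hθ => by simp only [hpq θ hθ]
  rw [e1, ← setLIntegral_map (f := fun t => ENNReal.ofReal (q t)) hA hq.ennreal_ofReal hm,
    map_smul_sub_volume hs, Measure.restrict_smul, lintegral_smul_measure, smul_eq_mul,
    ENNReal.toReal_mul, ENNReal.toReal_ofReal (by positivity),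
    integral_eq_lintegral_of_nonneg_ae (Eventually.of_forall hq0) hq.aestronglyMeasurable]

lemma integral_multivariateGaussian_inv {J : Matrix (Fin d) (Fin d) ℝ} (hJ : J.PosDef)
    (f : Param d → ℝ) : ∫ x, f x ∂(multivariateGaussian 0 J⁻¹) =
      √J.det / (2 * Real.pi) ^ ((d : ℝ) / 2) * ∫ x, f x * Real.exp (-(quadForm J x / 2)) := by
  have hm := measurable_quadForm J
  rw [multivariateGaussian_eq_withDensity hJ.inv,
    Matrix.nonsing_inv_nonsing_inv _ (isUnit_iff_ne_zero.2 hJ.det_pos.ne'),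
    integral_withDensity_ofReal (by fun_prop) (fun x => by positivity), ← integral_const_mul]
  congr 1; ext x
  ring

lemma setIntegral_multivariateGaussian_inv {J : Matrix (Fin d) (Fin d) ℝ} (hJ : J.PosDef)
    (f : Param d → ℝ) {A : Set (Param d)} (hA : MeasurableSet A) :
    ∫ x in A, f x ∂(multivariateGaussian 0 J⁻¹) =
      √J.det / (2 * Real.pi) ^ ((d : ℝ) / 2) *
        ∫ x in A, f x * Real.exp (-(quadForm J x / 2)) := by
  rw [← integral_indicator hA, integral_multivariateGaussian_inv hJ, ← integral_indicator hA]
  simp only [Set.indicator_mul_left]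

lemma multivariateGaussian_inv_real {J : Matrix (Fin d) (Fin d) ℝ} (hJ : J.PosDef)
    {A : Set (Param d)} (hA : MeasurableSet A) :
    (multivariateGaussian 0 J⁻¹).real A =
      √J.det / (2 * Real.pi) ^ ((d : ℝ) / 2) * ∫ x in A, Real.exp (-(quadForm J x / 2)) := by
  have := setIntegral_multivariateGaussian_inv hJ (fun _ => 1) hA
  simpa using this

lemma setIntegral_closedBall_exp_quadForm {J : Matrix (Fin d) (Fin d) ℝ} {s : ℝ} (hs : 0 < s)
    (c : Param d) (δ : ℝ) :
    ∫ θ in Metric.closedBall c δ, Real.exp (-(s ^ 2 * quadForm J (θ - c) / 2)) =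
      (s ^ d)⁻¹ * ∫ t in Metric.closedBall 0 (δ * s), Real.exp (-(quadForm J t / 2)) := by
  have hmJ := measurable_quadForm J
  have hm : Measurable fun θ : Param d => s • (θ - c) := by fun_prop
  have hpre : (fun θ : Param d => s • (θ - c)) ⁻¹' Metric.closedBall 0 (δ * s) =
      Metric.closedBall c δ := by
    ext θ
    simp only [Set.mem_preimage, mem_closedBall_iff_norm, sub_zero, norm_smul,
      Real.norm_of_nonneg hs.le]
    rw [mul_comm, mul_le_mul_iff_left₀ hs]
  have h := setIntegral_map (μ := (volume : Measure (Param d)))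
    (f := fun t => Real.exp (-(quadForm J t / 2))) (s := Metric.closedBall 0 (δ * s))
    (g := fun θ : Param d => s • (θ - c)) Metric.isClosed_closedBall.measurableSet
    (by fun_prop) hm.aemeasurable
  rw [hpre, map_smul_sub_volume hs, Measure.restrict_smul, integral_smul_measure] at h
  simp only [quadForm_smul_vec] at h
  rw [← h, ENNReal.toReal_ofReal (by positivity), smul_eq_mul]

end Rescaled

/-! ### The rescaled log-density around its maximum -/

section Local

variable {d : ℕ} {f : Param d → ℝ} {θ₀ : Param d} {s M δ lam : ℝ} {J : Matrix (Fin d) (Fin d) ℝ}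

/-- The Hessian is Lipschitz with constant `s² M`, so within distance `δ` it moves by at most `s² M
δ` from its value at the centre. -/
lemma hessian_le_of_thirdDerivNorm_le (hM : 0 ≤ M)
    (hd : ∀ θ, ‖θ - θ₀‖ ≤ δ → ThriceDifferentiableAt f θ)
    (hb : ∀ θ, ‖θ - θ₀‖ ≤ δ → thirdDerivNorm f θ ≤ s ^ 2 * M)
    (hJ : ∀ v, s ^ 2 * quadForm J v = -fderiv ℝ (fderiv ℝ f) θ₀ v v)
    (hlam : ∀ v, lam * ‖v‖ ^ 2 ≤ quadForm J v) {θ : Param d} (hθ : ‖θ - θ₀‖ ≤ δ) (h : Param d) :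
    fderiv ℝ (fderiv ℝ f) θ h h ≤ -(s ^ 2 * (lam - δ * M)) * ‖h‖ ^ 2 := by
  have h1 := norm_fderiv_fderiv_sub_le (by positivity) hd hb hθ
  have h2 : |fderiv ℝ (fderiv ℝ f) θ h h - fderiv ℝ (fderiv ℝ f) θ₀ h h| ≤
      s ^ 2 * M * δ * ‖h‖ * ‖h‖ := by
    have := (fderiv ℝ (fderiv ℝ f) θ - fderiv ℝ (fderiv ℝ f) θ₀).le_opNorm₂ h h
    refine this.trans ?_
    gcongr
    exact h1.trans (by gcongr)
  have h3 := hJ h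
  have h4 := mul_le_mul_of_nonneg_left (hlam h) (sq_nonneg s)
  have h5 := (abs_le.1 h2).2
  nlinarith

/-- In the variable `t = s (θ - θ₀)` the factor `s²` cancels from the curvature, leaving `lam - δ
M`. The gradients differ by at most `s² M ‖t / s‖² / 2` in `θ`, and the chain rule contributes
another `1 / s`; hence `b = M ‖t‖² / (2s)`. -/
theorem abs_gaussian_sub_gibbs_le (hs : 0 < s) (hδ : 0 < δ) (hM : 0 ≤ M)
    (hd : ∀ θ, ‖θ - θ₀‖ ≤ δ → ThriceDifferentiableAt f θ)
    (hb : ∀ θ, ‖θ - θ₀‖ ≤ δ → thirdDerivNorm f θ ≤ s ^ 2 * M)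
    (h0 : fderiv ℝ f θ₀ = 0)
    (hJ : ∀ v, s ^ 2 * quadForm J v = -fderiv ℝ (fderiv ℝ f) θ₀ v v)
    (hlam : ∀ v, lam * ‖v‖ ^ 2 ≤ quadForm J v) (hρ : 0 < lam - δ * M) {V : Param d → ℝ}
    (hV : Measurable V)
    (hVf : ∀ t ∈ Metric.closedBall (0 : Param d) (δ * s), V t = -f (θ₀ + s⁻¹ • t))
    {A : Set (Param d)} (hA : MeasurableSet A) :
    |(∫ x in A ∩ Metric.closedBall 0 (δ * s), Real.exp (-(quadForm J x / 2))) /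
        (∫ x in Metric.closedBall 0 (δ * s), Real.exp (-(quadForm J x / 2))) -
      (∫ x in A ∩ Metric.closedBall 0 (δ * s), Real.exp (-V x)) /
        (∫ x in Metric.closedBall 0 (δ * s), Real.exp (-V x))| ≤
    √((∫ x in Metric.closedBall (0 : Param d) (δ * s),
        (M * ‖x‖ ^ 2 / (2 * s)) ^ 2 * Real.exp (-(quadForm J x / 2))) /
      (∫ x in Metric.closedBall (0 : Param d) (δ * s), Real.exp (-(quadForm J x / 2))) /
      (4 * (lam - δ * M))) := by
  set K := Metric.closedBall (0 : Param d) (δ * s) with hK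
  have hKcomp : IsCompact K := isCompact_closedBall _ _
  set Q := fderiv ℝ (fderiv ℝ f) θ₀ with hQ
  have hscale : ∀ t ∈ K, ‖s⁻¹ • t‖ ≤ δ := fun t ht => by
    rw [hK, mem_closedBall_zero_iff] at ht
    rw [norm_smul, norm_inv, Real.norm_of_nonneg hs.le, inv_mul_le_iff₀ hs, mul_comm]
    exact ht
  have hin : ∀ t ∈ K, ‖θ₀ + s⁻¹ • t - θ₀‖ ≤ δ := fun t ht => by
    rw [add_sub_cancel_left]; exact hscale t ht
  have hmem : ∀ t ∈ K, θ₀ + s⁻¹ • t ∈ Metric.closedBall θ₀ δ := fun t ht => by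
    rw [mem_closedBall_iff_norm]; exact hin t ht
  have hnorm : ∀ x y : Param d, ‖s⁻¹ • x - s⁻¹ • y‖ = s⁻¹ * ‖x - y‖ := fun x y => by
    rw [← smul_sub, norm_smul, norm_inv, Real.norm_of_nonneg hs.le]
  -- Strong concavity of `f` about an arbitrary base point. It serves twice: from the midpoint for
  -- convexity of `V`, and from `x` for the increment of `V - W`.
  have hup : ∀ x ∈ K, ∀ y ∈ K, f (θ₀ + s⁻¹ • y) ≤ f (θ₀ + s⁻¹ • x) +
      fderiv ℝ f (θ₀ + s⁻¹ • x) (s⁻¹ • y - s⁻¹ • x) -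
        (lam - δ * M) / 2 * ‖y - x‖ ^ 2 := fun x hx y hy => by
    have := le_add_fderiv_add_of_hessian_le (convex_closedBall θ₀ δ)
      (fun θ hθ => hd θ (mem_closedBall_iff_norm.1 hθ))
      (fun θ hθ h => hessian_le_of_thirdDerivNorm_le hM hd hb hJ hlam
        (mem_closedBall_iff_norm.1 hθ) h) (hmem x hx) (hmem y hy)
    rw [add_sub_add_left_eq_sub, hnorm] at this
    refine this.trans (le_of_eq ?_)
    field_simp
    ring
  have hcont : ContinuousOn (fun t => -f (θ₀ + s⁻¹ • t)) K := fun t ht => by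
    have h1 : ContinuousAt f (θ₀ + s⁻¹ • t) := (hd _ (hin t ht)).differentiableAt.continuousAt
    have h2 : ContinuousAt (fun t : Param d => θ₀ + s⁻¹ • t) t := by fun_prop
    exact (h1.comp (f := fun t : Param d => θ₀ + s⁻¹ • t) h2).neg.continuousWithinAt
  have hmJ := measurable_quadForm J
  obtain ⟨B₁, hB₁⟩ := hKcomp.exists_bound_of_continuousOn hcont
  obtain ⟨B₂, hB₂⟩ := hKcomp.exists_bound_of_continuousOn
    (f := fun t => quadForm J t / 2) (by unfold quadForm; fun_prop)
  have hs0 : 0 < δ * s := by positivity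
  refine abs_gibbs_sub_gibbs_le (V := V) (W := fun t => quadForm J t / 2)
    (b := fun t => M * ‖t‖ ^ 2 / (2 * s)) (B := max B₁ B₂) (A := M * (δ * s) ^ 2 / (2 * s))
    (C := ‖Q‖ / (2 * s ^ 2)) (midpointPrekopaLeindler_euclidean d)
    Metric.isClosed_closedBall.measurableSet (convex_closedBall _ _)
    (Metric.measure_closedBall_pos volume _ hs0).ne' hKcomp.measure_lt_top.ne hV (by fun_prop)
    (by fun_prop) hρ (by positivity) (fun x hx => ?_) (fun x hx => ?_) (fun x hx => ?_)
    (fun x hx y hy => ?_) (fun x hx y hy => ?_) hA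
  · rw [hVf x hx]
    exact (hB₁ x hx).trans (le_max_left _ _)
  · exact (hB₂ x hx).trans (le_max_right _ _)
  · rw [abs_of_nonneg (by positivity)]
    have := mem_closedBall_zero_iff.1 hx
    gcongr
  · have hm : (2⁻¹ : ℝ) • (x + y) ∈ K := by
      rw [smul_add]
      exact convex_closedBall _ _ hx hy (by norm_num) (by norm_num) (by norm_num)
    rw [hVf x hx, hVf y hy, hVf _ hm]
    have h1 := hup _ hm x hx
    have h2 := hup _ hm y hy
    have ex : x - (2⁻¹ : ℝ) • (x + y) = (2⁻¹ : ℝ) • (x - y) := by module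
    have ey : y - (2⁻¹ : ℝ) • (x + y) = -((2⁻¹ : ℝ) • (x - y)) := by module
    rw [← smul_sub, ex, norm_smul] at h1
    rw [← smul_sub, ey, norm_neg, norm_smul, smul_neg, map_neg] at h2
    rw [norm_inv, Real.norm_two] at h1 h2
    linarith
  · rw [hVf x hx, hVf y hy]
    set u := s⁻¹ • x with hu
    set v := s⁻¹ • y with hv
    have hq : ∀ t : Param d, quadForm J t = -Q (s⁻¹ • t) (s⁻¹ • t) := fun t => by
      rw [← hJ, quadForm_smul_vec]
      field_simp
    have h1 := hup x hx y hy
    have h2 : 0 ≤ (lam - δ * M) / 2 * ‖y - x‖ ^ 2 := by positivity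
    have h3 := norm_fderiv_sub_taylor_le (by positivity) hd hb (hscale x hx)
    rw [h0, sub_zero] at h3
    have h4 : (fderiv ℝ f (θ₀ + u) - Q u) (v - u) ≤ s ^ 2 * M * ‖u‖ ^ 2 / 2 * ‖v - u‖ :=
      (le_abs_self _).trans (((fderiv ℝ f (θ₀ + u) - Q u).le_opNorm _).trans (by gcongr))
    -- The increment of `-f` has a second-order term of favourable sign, so only the quadratic form
    -- `Q` contributes to `C`.
    have h5 : -Q (v - u) (v - u) ≤ ‖Q‖ * ‖v - u‖ * ‖v - u‖ :=
      (neg_le_abs _).trans (Q.le_opNorm₂ _ _)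
    have hsym : Q u v = Q v u := (hd θ₀ (by simpa using hδ.le)).fderiv_fderiv_comm u v
    have hvu : ‖v - u‖ = s⁻¹ * ‖x - y‖ := by rw [hnorm, norm_sub_rev]
    have hun : ‖u‖ = s⁻¹ * ‖x‖ := by
      rw [hu, norm_smul, norm_inv, Real.norm_of_nonneg hs.le]
    rw [hvu] at h4 h5
    rw [hun] at h4
    have e4 : s ^ 2 * M * (s⁻¹ * ‖x‖) ^ 2 / 2 * (s⁻¹ * ‖x - y‖) =
        M * ‖x‖ ^ 2 / (2 * s) * ‖x - y‖ := by field_simp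
    have e5 : ‖Q‖ * (s⁻¹ * ‖x - y‖) * (s⁻¹ * ‖x - y‖) =
        2 * (‖Q‖ / (2 * s ^ 2) * ‖x - y‖ ^ 2) := by field_simp
    rw [e4] at h4
    rw [e5] at h5
    simp only [hq, ← hu, ← hv]
    simp only [map_sub, _root_.sub_apply] at h4 h5 h1
    linarith

end Local

/-! ### The mass of the posterior far from its mode -/

section Posterior

variable {d : ℕ} {prior L : Param d → ℝ}

lemma IsProbDensity.integrable (hprior : IsProbDensity prior) : Integrable prior := by
  refine ⟨hprior.aemeasurable.aestronglyMeasurable, ?_⟩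
  rw [hasFiniteIntegral_iff_ofReal (Eventually.of_forall hprior.nonneg), hprior.lintegral_eq_one]
  exact ENNReal.one_lt_top

lemma integrable_exp_mul_prior (hprior : IsProbDensity prior) (hL : AEMeasurable L volume) {B : ℝ}
    (hB : ∀ θ, L θ ≤ B) : Integrable fun θ => Real.exp (L θ) * prior θ := by
  refine hprior.integrable.bdd_mul (c := Real.exp B)
    (Real.measurable_exp.comp_aemeasurable hL).aestronglyMeasurable
    (Eventually.of_forall fun θ => ?_)
  rw [Real.norm_eq_abs, Real.abs_exp]
  exact Real.exp_le_exp.2 (hB θ)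

/-- Keep only the ball around `c`, where the prior is at least `1 / m` and the likelihood dominates
a Gaussian profile. -/
lemma le_normConst (hprior : IsProbDensity prior) (hL : AEMeasurable L volume) {c : Param d}
    (hmax : ∀ θ, L θ ≤ L c) {J : Matrix (Fin d) (Fin d) ℝ} {s δ m : ℝ} (hs : 0 < s) (hm : 0 < m)
    (hpos : ∀ θ, ‖θ - c‖ ≤ δ → 0 < prior θ) (hinv : ∀ θ, ‖θ - c‖ ≤ δ → |1 / prior θ| ≤ m)
    (hquad : ∀ h, ‖h‖ ≤ δ → L c - s ^ 2 * quadForm J h / 2 ≤ L (c + h)) :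
    Real.exp (L c) / m *
        ((s ^ d)⁻¹ * ∫ t in Metric.closedBall 0 (δ * s), Real.exp (-(quadForm J t / 2))) ≤
      normConst prior L := by
  have hi := integrable_exp_mul_prior hprior hL hmax
  rw [normConst, ← setIntegral_closedBall_exp_quadForm hs c δ, ← integral_const_mul]
  refine le_trans ?_ (setIntegral_le_integral (s := Metric.closedBall c δ) hi
    (Eventually.of_forall fun θ => mul_nonneg (Real.exp_pos _).le (hprior.nonneg θ)))
  refine setIntegral_mono_on ?_ hi.integrableOn Metric.isClosed_closedBall.measurableSet
    fun θ hθ => ?_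
  · refine ContinuousOn.integrableOn_compact (isCompact_closedBall _ _) ?_
    unfold quadForm
    fun_prop
  · rw [mem_closedBall_iff_norm] at hθ
    have h1 := hquad _ hθ
    rw [add_sub_cancel] at h1
    have h2 := hinv θ hθ
    have h3 := hpos θ hθ
    rw [abs_of_pos (by positivity)] at h2
    have h4 : 1 / m ≤ prior θ := by rwa [one_div_le hm h3]
    calc Real.exp (L c) / m * Real.exp (-(s ^ 2 * quadForm J (θ - c) / 2))
        = Real.exp (L c - s ^ 2 * quadForm J (θ - c) / 2) * (1 / m) := by
          rw [sub_eq_add_neg (L c), Real.exp_add]; ring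
      _ ≤ Real.exp (L θ) * prior θ := by gcongr

/-- On `A` the likelihood is at most `exp B`, and the prior has total mass one. -/
lemma posterior_real_le (hprior : IsProbDensity prior) (hz : 0 < normConst prior L)
    {A : Set (Param d)} (hA : MeasurableSet A) {B : ℝ} (hB : ∀ θ ∈ A, L θ ≤ B) :
    (posterior prior L).real A ≤ Real.exp B / normConst prior L := by
  rw [measureReal_def, posterior, withDensity_apply _ hA]
  have h : ∫⁻ θ in A, ENNReal.ofReal (postDensity prior L θ) ≤
      ENNReal.ofReal (Real.exp B / normConst prior L) := by
    calc ∫⁻ θ in A, ENNReal.ofReal (postDensity prior L θ)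
        ≤ ∫⁻ θ in A, ENNReal.ofReal (Real.exp B / normConst prior L) *
            ENNReal.ofReal (prior θ) := by
          refine setLIntegral_mono' hA fun θ hθ => ?_
          rw [← ENNReal.ofReal_mul (by positivity)]
          apply ENNReal.ofReal_le_ofReal
          rw [postDensity, div_mul_eq_mul_div]
          have := hB θ hθ
          have := hprior.nonneg θ
          gcongr
      _ ≤ ∫⁻ θ, ENNReal.ofReal (Real.exp B / normConst prior L) *
            ENNReal.ofReal (prior θ) := setLIntegral_le_lintegral _ _
      _ = _ := by
          rw [lintegral_const_mul' _ _ ENNReal.ofReal_ne_top, hprior.lintegral_eq_one, mul_one]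
  exact ENNReal.toReal_le_of_le_ofReal (by positivity) h

end Posterior

/-! ### Total variation after truncation -/

/-- Conditioning on `K` changes the mass of `A` by `ν (A \ K) - r ν Kᶜ` with `r` the conditional
probability, a difference of two numbers in `[0, ν Kᶜ]`. The constant `1` would thus do; `2` is all
that is needed. -/
lemma abs_real_sub_real_le_of_truncation {Ω : Type*} [MeasurableSpace Ω] {μ ν : Measure Ω}
    [IsProbabilityMeasure μ] [IsProbabilityMeasure ν] {K A : Set Ω} (hK : MeasurableSet K)
    (hμ : 0 < μ.real K) (hν : 0 < ν.real K) {T : ℝ}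
    (h : |ν.real (A ∩ K) / ν.real K - μ.real (A ∩ K) / μ.real K| ≤ T) :
    |μ.real A - ν.real A| ≤ T + 2 * ν.real Kᶜ + 2 * μ.real Kᶜ := by
  have key : ∀ (ν : Measure Ω) [IsProbabilityMeasure ν], 0 < ν.real K →
      |ν.real A - ν.real (A ∩ K) / ν.real K| ≤ 2 * ν.real Kᶜ := by
    intro ν _ hν
    have e1 := measureReal_inter_add_sdiff (μ := ν) (s := A) hK
    have e2 := probReal_compl_eq_one_sub (μ := ν) hK
    have e3 : ν.real (A \ K) ≤ ν.real Kᶜ := measureReal_mono fun x hx => hx.2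
    have e4 : ν.real (A ∩ K) ≤ ν.real K := measureReal_mono fun x hx => hx.2
    have e5 : 0 ≤ ν.real (A \ K) := measureReal_nonneg
    have e6 : 0 ≤ ν.real (A ∩ K) := measureReal_nonneg
    have hle : ν.real K ≤ 1 := measureReal_le_one
    set r := ν.real (A ∩ K) / ν.real K with hr
    have hr0 : 0 ≤ r := by positivity
    have hr1 : r ≤ 1 := (div_le_one hν).2 e4
    have hrK : ν.real (A ∩ K) = r * ν.real K := by rw [hr]; field_simp
    have h1 : r * ν.real Kᶜ ≤ ν.real Kᶜ := mul_le_of_le_one_left measureReal_nonneg hr1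
    have h2 : 0 ≤ r * ν.real Kᶜ := by positivity
    have h3 : ν.real A - r = ν.real (A \ K) - r * ν.real Kᶜ := by
      rw [← e1, hrK, e2]; ring
    rw [h3, abs_le]
    constructor <;> linarith
  have h1 := abs_le.1 (key μ hμ)
  have h2 := abs_le.1 (key ν hν)
  have h3 := abs_le.1 h
  rw [abs_le]
  constructor <;> linarith

lemma one_sub_pos_exp {a b : ℝ} (ha : a ≠ 0) (hb : 0 < b) :
    0 < 1 - Real.exp (-(1 / 2) * a ^ 2 * b) := by
  have : Real.exp (-(1 / 2) * a ^ 2 * b) < 1 := by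
    rw [Real.exp_lt_one_iff]
    have : 0 < a ^ 2 * b := by positivity
    nlinarith
  linarith

lemma sqrt_three_mul_sq_div {y X : ℝ} (hy : 0 ≤ y) :
    √(3 * y ^ 2 / (4 ^ 2 * X)) = √3 * y / (4 * √X) := by
  rw [Real.sqrt_div (by positivity), Real.sqrt_mul (by norm_num), Real.sqrt_mul (by norm_num),
    Real.sqrt_sq hy, Real.sqrt_sq (by norm_num)]

lemma compl_closedBall_zero {d : ℕ} (R : ℝ) :
    (Metric.closedBall (0 : Param d) R)ᶜ = {x | R < ‖x‖} := by
  ext x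
  simp

end LaplaceApprox

end
-- The total variation bound
open LaplaceApprox in
theorem mainTheorem1 {d : ℕ} (n : ℕ) (hn : 0 < n)
    -- the prior density, the generalized log-likelihood, the MLE and the MAP
    (prior L : LaplaceApprox.Param d → ℝ)
    (hprior : LaplaceApprox.IsProbDensity prior) (hL : AEMeasurable L volume)
    (θhat θbar : LaplaceApprox.Param d)
    (hMLE : LaplaceApprox.IsMLE L θhat) (hMAP : LaplaceApprox.IsMAP prior L θbar)
    (δ δbar M₂ Mbar₂ Mhat₁ κbar : ℝ)
    (hδ : 0 < δ) (hδbar : 0 < δbar) (hM₂ : 0 < M₂) (hMbar₂ : 0 < Mbar₂) (hMhat₁ : 0 < Mhat₁)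
    (hκbar : 0 < κbar)
    -- third derivative of the log-likelihood around the MLE
    (hL_diff : ∀ θ, ‖θ - θhat‖ ≤ δ → LaplaceApprox.ThriceDifferentiableAt L θ)
    (hL_third : ∀ θ, ‖θ - θhat‖ ≤ δ → LaplaceApprox.thirdDerivNorm L θ / n ≤ M₂)
    -- prior bounded away from zero around the MLE
    (hprior_pos : ∀ θ, ‖θ - θhat‖ ≤ δ → 0 < prior θ)
    (hprior_inv : ∀ θ, ‖θ - θhat‖ ≤ δ → |1 / prior θ| ≤ Mhat₁)
    -- the log-prior and the log-posterior around the MAP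
    (hprior_pos_MAP : ∀ θ, ‖θ - θbar‖ ≤ δbar → 0 < prior θ)
    (hlogprior_diff : ∀ θ, ‖θ - θbar‖ ≤ δbar →
      LaplaceApprox.ThriceDifferentiableAt (fun t => Real.log (prior t)) θ)
    (hpost_diff : ∀ θ, ‖θ - θbar‖ ≤ δbar →
      LaplaceApprox.ThriceDifferentiableAt (LaplaceApprox.logPosterior prior L) θ)
    (hpost_third : ∀ θ, ‖θ - θbar‖ ≤ δbar →
      LaplaceApprox.thirdDerivNorm (LaplaceApprox.logPosterior prior L) θ / n ≤ Mbar₂)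
    -- size of the two neighbourhoods
    (hsize_bar : max ‖θhat - θbar‖
      √((LaplaceApprox.Jbar n prior L θbar)⁻¹.trace / n) < δbar)
    (hsize : √((LaplaceApprox.JhatP n L M₂ θhat δ)⁻¹.trace / n) < δ)
    -- strong concavity of the log-posterior at the MAP
    (hlam : δbar * Mbar₂ < LaplaceApprox.lamBar n prior L θbar)
    -- strict optimality of the MLE
    (hκ : ∀ θ, δbar - ‖θhat - θbar‖ < ‖θ - θhat‖ → (L θ - L θhat) / n ≤ -κbar)
    -- a random variable distributed according to the generalized posterior
    {Ω : Type*} [MeasurableSpace Ω] (P : Measure Ω) [IsProbabilityMeasure P]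
    (θtilde : Ω → LaplaceApprox.Param d)
    (hθtilde : HasLaw θtilde (LaplaceApprox.posterior prior L) P) :
    LaplaceApprox.tvDist (P.map fun ω => √(n : ℝ) • (θtilde ω - θbar))
        (multivariateGaussian 0 (LaplaceApprox.Jbar n prior L θbar)⁻¹) ≤
      √3 * (LaplaceApprox.Jbar n prior L θbar)⁻¹.trace * Mbar₂ /
          (4 * √(n * (LaplaceApprox.lamBar n prior L θbar - δbar * Mbar₂) *
            (1 - LaplaceApprox.decayBar n prior L θbar δbar))) +
        2 * LaplaceApprox.decayBar n prior L θbar δbar +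
        2 * (n : ℝ) ^ ((d : ℝ) / 2) * Real.exp (-(n * κbar)) * Mhat₁ *
            √|(LaplaceApprox.JhatP n L M₂ θhat δ).det| /
          ((2 * Real.pi) ^ ((d : ℝ) / 2) *
            (1 - LaplaceApprox.decayHatP n L M₂ θhat δ)) := by
  have hn0 : (0 : ℝ) < n := by exact_mod_cast hn
  set s := √(n : ℝ) with hs_def
  have hs : 0 < s := Real.sqrt_pos.2 hn0
  have hs2 : s ^ 2 = n := Real.sq_sqrt hn0.le
  have hsd : s ^ d = (n : ℝ) ^ ((d : ℝ) / 2) := by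
    rw [hs_def, Real.sqrt_eq_rpow, ← Real.rpow_natCast, ← Real.rpow_mul hn0.le]
    congr 1
    ring
  have hball_bar : ‖θbar - θbar‖ ≤ δbar := by simpa using hδbar.le
  have hball_hat : ‖θhat - θhat‖ ≤ δ := by simpa using hδ.le
  set lam := lamBar n prior L θbar with hlam_def
  have hlam0 : 0 < lam := lt_trans (by positivity) hlam
  set J := Jbar n prior L θbar with hJ_def
  set Jp := JhatP n L M₂ θhat δ with hJp_def
  have hne : Nonempty (Fin d) := by
    by_contra hempty
    rw [not_nonempty_iff] at hempty
    have : {μ : ℝ | Module.End.HasEigenvalue (Matrix.toLin' J) μ} = ∅ := by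
      ext μ
      simp only [Set.mem_ofPred_eq, Set.mem_empty_iff_false, iff_false]
      intro h
      obtain ⟨v, hv⟩ := h.exists_hasEigenvector
      exact hv.2 (Subsingleton.elim _ _)
    rw [hlam_def, lamBar, minEigenvalue, ← hJ_def, this, Real.sInf_empty] at hlam0
    exact lt_irrefl _ hlam0
  -- the two precision matrices
  have hJherm : J.IsHermitian :=
    ((isHermitian_hessian (hpost_diff θbar hball_bar)).smul (IsSelfAdjoint.all _)).neg
  have hJpos : J.PosDef := posDef_of_minEigenvalue_pos hJherm hlam0
  have hJquad : ∀ v, s ^ 2 * quadForm J v =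
      -fderiv ℝ (fderiv ℝ (logPosterior prior L)) θbar v v := fun v => by
    rw [hJ_def, Jbar, quadForm_neg_smul, quadForm_hessian, hs2]
    field_simp
  have hL_third' : ∀ θ, ‖θ - θhat‖ ≤ δ → thirdDerivNorm L θ ≤ s ^ 2 * M₂ := fun θ hθ => by
    rw [hs2, mul_comm]; exact (div_le_iff₀ hn0).1 (hL_third θ hθ)
  have hpost_third' : ∀ θ, ‖θ - θbar‖ ≤ δbar →
      thirdDerivNorm (logPosterior prior L) θ ≤ s ^ 2 * Mbar₂ := fun θ hθ => by
    rw [hs2, mul_comm]; exact (div_le_iff₀ hn0).1 (hpost_third θ hθ)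
  have hJpquad : ∀ v, s ^ 2 * quadForm Jp v =
      -fderiv ℝ (fderiv ℝ L) θhat v v + s ^ 2 * (δ * M₂ / 3) * ‖v‖ ^ 2 := fun v => by
    rw [hJp_def, JhatP, quadForm_add_smul_one, Jhat, quadForm_neg_smul, quadForm_hessian, hs2]
    field_simp
  have hJppos : Jp.PosDef := by
    refine posDef_of_quadForm_pos ?_ fun v hv => ?_
    · exact (((isHermitian_hessian (hL_diff θhat hball_hat)).smul (IsSelfAdjoint.all _)).neg).add
        (Matrix.isHermitian_one.smul (IsSelfAdjoint.all _))
    · have h1 := fderiv_fderiv_nonpos_of_isMax hδ (by positivity) hL_diff hL_third' hMLE.1 v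
      have h2 : 0 < s ^ 2 * (δ * M₂ / 3) * ‖v‖ ^ 2 := by
        have := norm_pos_iff.2 hv
        positivity
      have h3 := hJpquad v
      exact pos_of_mul_pos_right (by linarith) (sq_nonneg s)
  -- Gaussian tails
  have htr : 0 < J⁻¹.trace := hJpos.inv.trace_pos
  have htrp : 0 < Jp⁻¹.trace := hJppos.inv.trace_pos
  have hR : √J⁻¹.trace < δbar * s := by
    have := (le_max_right _ _).trans_lt hsize_bar
    rwa [Real.sqrt_div htr.le, div_lt_iff₀ hs] at this
  have hRp : √Jp⁻¹.trace < δ * s := by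
    rwa [Real.sqrt_div htrp.le, div_lt_iff₀ hs] at hsize
  have hop : 0 < opNorm Jp⁻¹ := by
    obtain ⟨i⟩ := hne
    exact (hJppos.inv.eigenvalues_pos i).trans_le (eigenvalues_le_opNorm _ i)
  have hD : 0 < 1 - decayBar n prior L θbar δbar :=
    one_sub_pos_exp (sub_pos.2 hR).ne' hlam0
  have hDp : 0 < 1 - decayHatP n L M₂ θhat δ :=
    one_sub_pos_exp (sub_pos.2 hRp).ne' (inv_pos.2 hop)
  set D := decayBar n prior L θbar δbar with hD_def
  set Dp := decayHatP n L M₂ θhat δ with hDp_def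
  have htail : (multivariateGaussian 0 J⁻¹).real (Metric.closedBall 0 (δbar * s))ᶜ ≤ D := by
    rw [compl_closedBall_zero]
    refine (multivariateGaussian_norm_gt_le hJpos.inv.posSemidef (inv_pos.2 hlam0)
      (eigenvalues_inv_le hJpos hlam0 _) htr hR).trans (le_of_eq ?_)
    rw [hD_def, decayBar, inv_inv]
  have htailp : (multivariateGaussian 0 Jp⁻¹).real (Metric.closedBall 0 (δ * s))ᶜ ≤ Dp := by
    rw [compl_closedBall_zero]
    exact multivariateGaussian_norm_gt_le hJppos.inv.posSemidef hop
      (eigenvalues_le_opNorm _) htrp hRp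
  have hmassp : 1 - Dp ≤ (multivariateGaussian 0 Jp⁻¹).real (Metric.closedBall 0 (δ * s)) := by
    rw [probReal_compl_eq_one_sub Metric.isClosed_closedBall.measurableSet] at htailp
    linarith
  have hmass : 1 - D ≤ (multivariateGaussian 0 J⁻¹).real (Metric.closedBall 0 (δbar * s)) := by
    rw [probReal_compl_eq_one_sub Metric.isClosed_closedBall.measurableSet] at htail
    linarith
  -- the normalizing constant
  have hLgrad : fderiv ℝ L θhat = 0 := IsLocalMax.fderiv_eq_zero (Eventually.of_forall hMLE.1)
  have hLquad : ∀ h, ‖h‖ ≤ δ → L θhat - s ^ 2 * quadForm Jp h / 2 ≤ L (θhat + h) := fun h hh => by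
    have h1 := (abs_le.1 (abs_sub_taylor_le (by positivity) hL_diff hL_third' hh)).1
    rw [hLgrad, _root_.zero_apply] at h1
    have h2 := hJpquad h
    have h3 : s ^ 2 * M₂ * ‖h‖ ^ 3 / 6 ≤ s ^ 2 * (δ * M₂ / 3) * ‖h‖ ^ 2 / 2 := by
      have : s ^ 2 * M₂ * ‖h‖ ^ 2 * ‖h‖ ≤ s ^ 2 * M₂ * ‖h‖ ^ 2 * δ := by gcongr
      nlinarith
    linarith
  have hz := le_normConst hprior hL hMLE.1 hs hMhat₁ hprior_pos hprior_inv hLquad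
  have hpi : (0 : ℝ) < (2 * Real.pi) ^ ((d : ℝ) / 2) := by positivity
  have hdetp : 0 < √Jp.det := Real.sqrt_pos.2 hJppos.det_pos
  rw [multivariateGaussian_inv_real hJppos Metric.isClosed_closedBall.measurableSet] at hmassp
  set G := ∫ t in Metric.closedBall (0 : Param d) (δ * s), Real.exp (-(quadForm Jp t / 2)) with hG
  have hGlow : (1 - Dp) * (2 * Real.pi) ^ ((d : ℝ) / 2) / √Jp.det ≤ G := by
    rw [div_le_iff₀ hdetp]
    rw [div_mul_eq_mul_div, le_div_iff₀ hpi] at hmassp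
    linarith
  have hGpos : 0 < G := lt_of_lt_of_le (by positivity) hGlow
  have hz0 : 0 < normConst prior L := lt_of_lt_of_le (by positivity) hz
  -- the rescaled posterior
  have hmT : Measurable fun θ : Param d => s • (θ - θbar) := by fun_prop
  set μ := P.map fun ω => s • (θtilde ω - θbar) with hμ_def
  have hμ : μ = (posterior prior L).map fun θ => s • (θ - θbar) := by
    rw [← hθtilde.map_eq, AEMeasurable.map_map_of_aemeasurable hmT.aemeasurable
      hθtilde.aemeasurable]
    rfl
  have hμprob : IsProbabilityMeasure μ :=
    Measure.isProbabilityMeasure_map (hmT.comp_aemeasurable hθtilde.aemeasurable)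
  set K := Metric.closedBall (0 : Param d) (δbar * s) with hK_def
  have hK : MeasurableSet K := Metric.isClosed_closedBall.measurableSet
  have hTK : ∀ θ, s • (θ - θbar) ∈ K ↔ ‖θ - θbar‖ ≤ δbar := fun θ => by
    rw [hK_def, mem_closedBall_zero_iff, norm_smul, Real.norm_of_nonneg hs.le, mul_comm,
      mul_le_mul_iff_left₀ hs]
  have hfar : μ.real Kᶜ ≤ (n : ℝ) ^ ((d : ℝ) / 2) * Real.exp (-(n * κbar)) * Mhat₁ *
      √|Jp.det| / ((2 * Real.pi) ^ ((d : ℝ) / 2) * (1 - Dp)) := by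
    rw [hμ, map_measureReal_apply hmT hK.compl]
    have h1 : (posterior prior L).real ((fun θ => s • (θ - θbar)) ⁻¹' Kᶜ) ≤
        Real.exp (L θhat - n * κbar) / normConst prior L := by
      refine posterior_real_le hprior hz0 (hK.compl.preimage hmT) fun θ hθ => ?_
      have h2 : δbar < ‖θ - θbar‖ := not_le.1 fun h => hθ ((hTK θ).2 h)
      have h3 : ‖θ - θbar‖ ≤ ‖θ - θhat‖ + ‖θhat - θbar‖ := norm_sub_le_norm_sub_add_norm_sub _ _ _
      have h4 := (div_le_iff₀ hn0).1 (hκ θ (by linarith))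
      linarith
    refine h1.trans ?_
    have h5 : Real.exp (L θhat) / Mhat₁ * ((s ^ d)⁻¹ *
        ((1 - Dp) * (2 * Real.pi) ^ ((d : ℝ) / 2) / √Jp.det)) ≤ normConst prior L :=
      le_trans (by gcongr) hz
    calc Real.exp (L θhat - n * κbar) / normConst prior L
        ≤ Real.exp (L θhat - n * κbar) / (Real.exp (L θhat) / Mhat₁ * ((s ^ d)⁻¹ *
          ((1 - Dp) * (2 * Real.pi) ^ ((d : ℝ) / 2) / √Jp.det))) := by gcongr
      _ = _ := by
        rw [sub_eq_add_neg, Real.exp_add, abs_of_pos hJppos.det_pos, ← hsd]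
        field_simp
  -- the density of the rescaled posterior on `K`
  have hpostpos : ∀ θ, ‖θ - θbar‖ ≤ δbar → 0 < postDensity prior L θ := fun θ hθ =>
    div_pos (mul_pos (Real.exp_pos _) (hprior_pos_MAP θ hθ)) hz0
  have hgrad : fderiv ℝ (logPosterior prior L) θbar = 0 := by
    refine IsLocalMax.fderiv_eq_zero ?_
    filter_upwards [Metric.closedBall_mem_nhds θbar hδbar] with θ hθ
    exact Real.log_le_log (hpostpos θ (mem_closedBall_iff_norm.1 hθ)) (hMAP.1 θ)
  set V : Param d → ℝ := K.indicator fun t => -logPosterior prior L (θbar + s⁻¹ • t) with hV_def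
  have hin : ∀ t ∈ K, ‖θbar + s⁻¹ • t - θbar‖ ≤ δbar := fun t ht => by
    rw [← hTK, add_sub_cancel_left, smul_smul, mul_inv_cancel₀ hs.ne', one_smul]
    exact ht
  have hVK : ∀ t ∈ K, V t = -logPosterior prior L (θbar + s⁻¹ • t) := fun t ht => by
    rw [hV_def, Set.indicator_of_mem ht]
  have hVcont : ContinuousOn (fun t => -logPosterior prior L (θbar + s⁻¹ • t)) K := by
    intro t ht
    have h1 : ContinuousAt (logPosterior prior L) (θbar + s⁻¹ • t) :=
      (hpost_diff _ (hin t ht)).differentiableAt.continuousAt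
    have h2 : ContinuousAt (fun t : Param d => θbar + s⁻¹ • t) t := by fun_prop
    exact (h1.comp (f := fun t : Param d => θbar + s⁻¹ • t) h2).neg.continuousWithinAt
  have hVm : Measurable V := by
    classical
    rw [hV_def, ← Set.piecewise_eq_indicator]
    exact ContinuousOn.measurable_piecewise hVcont continuousOn_const hK
  have hμreal : ∀ A ⊆ K, MeasurableSet A → μ.real A = (s ^ d)⁻¹ * ∫ t in A, Real.exp (-V t) := by
    intro A hAK hA
    rw [hμ, LaplaceApprox.posterior]
    refine map_withDensity_smul_sub_real (by fun_prop) (fun t => (Real.exp_pos _).le) hs θbar hA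
      fun θ hθ => ?_
    rw [hVK _ (hAK hθ), smul_smul, inv_mul_cancel₀ hs.ne', one_smul, add_sub_cancel, neg_neg,
      logPosterior, Real.exp_log (hpostpos θ ((hTK θ).1 (hAK hθ)))]
  have hνK : 0 < (multivariateGaussian 0 J⁻¹).real K := hD.trans_le hmass
  have hc : 0 < √J.det / (2 * Real.pi) ^ ((d : ℝ) / 2) :=
    div_pos (Real.sqrt_pos.2 hJpos.det_pos) hpi
  set c := √J.det / (2 * Real.pi) ^ ((d : ℝ) / 2) with hc_def
  have hρ : 0 < lam - δbar * Mbar₂ := by linarith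
  have hμK : 0 < μ.real K := by
    rw [hμreal K subset_rfl hK]
    have hKpos : volume K ≠ 0 := (Metric.measure_closedBall_pos volume _ (by positivity)).ne'
    have : NeZero ((volume : Measure (Param d)).restrict K) := ⟨by simpa using hKpos⟩
    refine mul_pos (by positivity) (integral_exp_pos ?_)
    exact ((hVcont.congr hVK).neg.rexp).integrableOn_compact (isCompact_closedBall _ _)
  -- the two truncated measures
  have hfourth : ∫ x in K, (Mbar₂ * ‖x‖ ^ 2 / (2 * s)) ^ 2 ∂(multivariateGaussian 0 J⁻¹) ≤
      Mbar₂ ^ 2 / (4 * n) * (3 * J⁻¹.trace ^ 2) := by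
    obtain ⟨i4, h4⟩ := integral_norm_pow_four_multivariateGaussian_le hJpos.inv.posSemidef
    have e : ∀ x : Param d, (Mbar₂ * ‖x‖ ^ 2 / (2 * s)) ^ 2 =
        Mbar₂ ^ 2 / (4 * n) * ‖x‖ ^ 4 := fun x => by
      rw [← hs2]; ring
    simp only [e]
    rw [integral_const_mul]
    refine mul_le_mul_of_nonneg_left (le_trans ?_ h4) (by positivity)
    exact setIntegral_le_integral i4 (Eventually.of_forall fun x => by positivity)
  have hcore : ∀ A, MeasurableSet A →
      |(multivariateGaussian 0 J⁻¹).real (A ∩ K) / (multivariateGaussian 0 J⁻¹).real K -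
        μ.real (A ∩ K) / μ.real K| ≤
      √3 * J⁻¹.trace * Mbar₂ / (4 * √(n * (lam - δbar * Mbar₂) * (1 - D))) := by
    intro A hA
    have key := abs_gaussian_sub_gibbs_le hs hδbar hMbar₂.le hpost_diff hpost_third' hgrad hJquad
      (lam := lam) (fun v => minEigenvalue_mul_norm_sq_le hJherm v) hρ hVm hVK hA
    rw [← hK_def] at key
    rw [hμreal _ Set.inter_subset_right (hA.inter hK), hμreal K subset_rfl hK,
      multivariateGaussian_inv_real hJpos (hA.inter hK), multivariateGaussian_inv_real hJpos hK,
      ← hc_def, mul_div_mul_left _ _ hc.ne', mul_div_mul_left _ _ (by positivity)]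
    refine key.trans ?_
    rw [setIntegral_multivariateGaussian_inv hJpos _ hK, ← hc_def] at hfourth
    rw [multivariateGaussian_inv_real hJpos hK, ← hc_def] at hmass
    have hb : √3 * J⁻¹.trace * Mbar₂ / (4 * √(n * (lam - δbar * Mbar₂) * (1 - D))) =
        √(Mbar₂ ^ 2 / (4 * n) * (3 * J⁻¹.trace ^ 2) / (1 - D) / (4 * (lam - δbar * Mbar₂))) := by
      rw [show Mbar₂ ^ 2 / (4 * n) * (3 * J⁻¹.trace ^ 2) / (1 - D) / (4 * (lam - δbar * Mbar₂)) =
        3 * (J⁻¹.trace * Mbar₂) ^ 2 / (4 ^ 2 * (n * (lam - δbar * Mbar₂) * (1 - D))) by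
          field_simp, sqrt_three_mul_sq_div (by positivity), mul_assoc]
    rw [hb, ← mul_div_mul_left (∫ x in K, _ * _) _ hc.ne']
    gcongr
  -- conclusion
  refine ciSup_le fun A => ?_
  have h := abs_real_sub_real_le_of_truncation hK hμK hνK (hcore A.1 A.2)
  refine h.trans ?_
  have e : 2 * (n : ℝ) ^ ((d : ℝ) / 2) * Real.exp (-(n * κbar)) * Mhat₁ *
      √|Jp.det| / ((2 * Real.pi) ^ ((d : ℝ) / 2) * (1 - Dp)) =
      2 * ((n : ℝ) ^ ((d : ℝ) / 2) * Real.exp (-(n * κbar)) * Mhat₁ *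
      √|Jp.det| / ((2 * Real.pi) ^ ((d : ℝ) / 2) * (1 - Dp))) := by ring
  rw [e]
  gcongr
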